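/- Let $G$ be a simple graph of order $n$ with adjacency matrix $A$, let $e$ be the all-one vector and $J$ the all-one $n\times n$ matrix. Let $W=[e,Ae,\ldots,A^{n-1}e]$ be the walk matrix of $G$ and $\Delta(G)=\prod_{i>j}(\alpha_i-\alpha_j)^2$ the discriminant of its characteristic polynomial, where $\alpha_1,\ldots,\alpha_n$ are the eigenvalues of $A$. Write $\chi(M;x)=\det(xI-M)$. The number $2^{-\lfloor n/2\rfloor}\det W$ is always an integer; put $\theta(G)=\gcd\{2^{-\lfloor n/2\rfloor}\det W,\Delta(G)\}$. For a prime $p$ let $\Phi_p(G;x)=\gcd\{\chi(A;x),\chi(A+J;x)\}\in\mathbb{F}_p[x]$, the gcd being taken over $\mathbb{F}_p$, and let $\mathrm{ord}_p(m)$ be the exponent of $p$ in the integer $m$, with $\mathrm{ord}_p(0)=\infty$. Suppose that $G$ is controllable, i.e. $\det W\neq 0$, and that $\theta(G)$ is odd. Suppose further that for every prime $p$ with $p^2\mid\theta(G)$ and every monic irreducible polynomial $\phi\in\mathbb{F}_p[x]$ with $\phi^2\mid\Phi_p(G;x)$, $$\min\{\mathrm{ord}_p(\det\phi(A)),\ \mathrm{ord}_p(\det\phi(A+J))\}=\deg\phi,$$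 where in the determinants $\phi$ is regarded as the polynomial in $\mathbb{Z}[x]$ with coefficients in $\{0,1,\ldots,p-1\}$. Then $G$ is determined by its generalized spectrum: every graph $H$ such that $H$ and $G$ have the same spectrum and their complements $\bar H$ and $\bar G$ have the same spectrum (as multisets of eigenvalues of the adjacency matrices) is isomorphic to $G$. -/

import Mathlib

open Polynomial

namespace GenSpectrum

open Classical in
/-- The adjacency matrix of `G`, as an integral matrix. -/
noncomputable def adj {n : ℕ} (G : SimpleGraph (Fin n)) : Matrix (Fin n) (Fin n) ℤ :=
  G.adjMatrix ℤ

/-- The all-one matrix `J`. -/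
def allOne (n : ℕ) : Matrix (Fin n) (Fin n) ℤ := Matrix.of fun _ _ => 1

/-- The spectrum of `G`: the multiset of eigenvalues of its adjacency matrix, that is, of the
roots of the characteristic polynomial counted with multiplicity. (They are all real.) -/
noncomputable def spec {n : ℕ} (G : SimpleGraph (Fin n)) : Multiset ℂ :=
  ((adj G).map (Int.cast : ℤ → ℂ)).charpoly.roots

/-- The generalized spectrum of `G`: the spectrum of `G` and that of its complement. -/
noncomputable def genSpec {n : ℕ} (G : SimpleGraph (Fin n)) : Multiset ℂ × Multiset ℂ :=
  (spec G, spec Gᶜ)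

/-- `G` is determined by its generalized spectrum: every finite graph (of any order) with the same
generalized spectrum is isomorphic to `G`. -/
def IsDGS {n : ℕ} (G : SimpleGraph (Fin n)) : Prop :=
  ∀ (m : ℕ) (H : SimpleGraph (Fin m)), genSpec H = genSpec G → Nonempty (H ≃g G)

/-- The walk matrix `W = [e, Ae, …, Aⁿ⁻¹e]`, with `e` the all-one vector. -/
noncomputable def walkMatrix {n : ℕ} (G : SimpleGraph (Fin n)) : Matrix (Fin n) (Fin n) ℤ :=
  Matrix.of fun i j => (((adj G) ^ (j : ℕ)).mulVec 1) i

/-- `G` is controllable if its walk matrix is nonsingular. -/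
def IsControllable {n : ℕ} (G : SimpleGraph (Fin n)) : Prop := (walkMatrix G).det ≠ 0

/-- The discriminant of `G`: the discriminant of the characteristic polynomial of `A`. -/
noncomputable def discriminant {n : ℕ} (G : SimpleGraph (Fin n)) : ℤ := (adj G).charpoly.discr

/-- `θ(G) = gcd (2^{-⌊n/2⌋} det W, Δ(G))`. The division is exact: `2^⌊n/2⌋` divides the determinant
of the walk matrix of every graph of order `n`. -/
noncomputable def theta {n : ℕ} (G : SimpleGraph (Fin n)) : ℕ :=
  Int.gcd ((walkMatrix G).det / 2 ^ (n / 2)) (discriminant G)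

open Classical in
/-- `Φ_p(G; x)`, the monic greatest common divisor over `𝔽_p` of the characteristic polynomials of
`A` and `A + J`. -/
noncomputable def Phi {n : ℕ} (p : ℕ) [Fact p.Prime] (G : SimpleGraph (Fin n)) : (ZMod p)[X] :=
  normalize (EuclideanDomain.gcd
    ((adj G).charpoly.map (Int.castRingHom (ZMod p)))
    ((adj G + allOne n).charpoly.map (Int.castRingHom (ZMod p))))

/-- The lift of `φ ∈ 𝔽_p[x]` to `ℤ[x]` all of whose coefficients lie in `{0, 1, …, p - 1}`. -/
noncomputable def lift {p : ℕ} (φ : (ZMod p)[X]) : ℤ[X] :=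
  ∑ i ∈ Finset.range (φ.natDegree + 1), C ((φ.coeff i).val : ℤ) * X ^ i

/-- `ord_p (det φ(M))` for an integral matrix `M`; it is `⊤` if the determinant is `0`. -/
noncomputable def ordDet {n p : ℕ} (φ : (ZMod p)[X]) (M : Matrix (Fin n) (Fin n) ℤ) : ℕ∞ :=
  emultiplicity (p : ℤ) (aeval M (lift φ)).det

end GenSpectrum

/-!
Let `H` be a graph with the generalized spectrum of `G`, with adjacency matrices `B` and `A`. By the
matrix determinant lemma the two characteristic polynomials determine the walk counts `eᵀ Aᵏ e`
(`walkCount_eq`), so `Wᵀ W` and `Wᵀ A W` agree with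
their counterparts for `H`. As `det W ≠ 0`, this yields
an integral matrix `U = l Q` with `Q` orthogonal, `Q e = e` and `A Q = Q B` (`IsIntertwiner`). Take
`l` minimal. If `l = 1`, then `U` is a permutation matrix and the graphs are isomorphic. Otherwise
let `p` be a prime divisor of `l`; then `U` is nonzero modulo `p`.

The contradiction comes from the columns of `U`. Any two vectors `v`, `v'` in their integral span
satisfy `vᵀ f(A) v' ≡ 0 (mod p²)` and `eᵀ f(A) v ≡ 0 (mod p)` for all integral polynomials `f`.
Modulo `p` they span a nonzero invariant subspace, on which `A` and `A + J` agree; choose `v` in it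
killed by an irreducible polynomial `φ` of degree `d`. One determinant estimate is used throughout
(`pow_succ_dvd_det`): if `d` independent vectors `vᵢ` satisfy `vᵢᵀ M ≡ 0` modulo a prime `p`, then
`p ^ d` divides `det M`, and `p ^ (d + 1)` does so if moreover `M w ≡ 0 (mod p)` and
`vᵢᵀ M w ≡ 0 (mod p²)` for some `w` that is nonzero modulo `p`.

* Over `𝔽_p[x]`, with the prime `φ`, `M = x - A` and `w` the eigenvector of `A` over `𝔽_p[x]/(φ)`
  obtained from `v`: `φ²` divides the characteristic polynomials of `A` and of `A + J`, hence `Φ_p`.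
* Over `ℤ`, with `vᵢ = Aⁱ v` and `M = f(A)` for any `f` divisible by `φ` modulo `p`: `p ^ (d + 1)`
  divides `det f(A)`. For `f = χ'` this gives `p² ∣ Δ`; for `f` the lift of `φ` it shows that both
  `det φ(A)` and `det φ(A + J)` have order greater than `d`.
* Over `ℤ`, with `M = W`: `p²` divides `det W`. Unless the left kernel of `W` modulo `p` is already
  too large, it is the line spanned by `v`. Then `φ` is linear, and `v ≡ r(A) e` because `v` is
  isotropic; for the minimal polynomial `q` of `e` one has `φ r ≡ b q` with a constant `b ≠ 0`, and
  evaluating `vᵀ φ(A) r(A) e` modulo `p²` shows that the coefficient vector of `q` is a suitable `w`.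

For odd `p` these facts give `p² ∣ θ(G)` and contradict the hypothesis on `φ`. For `p = 2` the walk
counts with `k ≥ 1` are even, so that `Wᵀ W = D K` with `det D = 4 ^ ⌊n/2⌋`, and the square
`h(x)² ≡ h(x²) (mod 2)` of a polynomial `h` with `v ≡ h(A) e` provides a kernel vector of `K` modulo
`2`. Hence `2 ^ (⌊n/2⌋ + 1)` divides `det W`, and as `2` divides `Δ`, `θ(G)` would be even.
-/

/-! ### Determinants modulo powers of a prime -/

namespace GenSpectrum

open Matrix

section Divisibility

variable {R F : Type*} [CommRing R] [Field F] {ι n : Type*} [Fintype n] [DecidableEq n]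

/-- Vectors that are independent over the residue field are rows of a square matrix whose
determinant is a unit in the residue field. -/
theorem exists_matrix_rows_of_linearIndependent (π : R →+* F) (hπ : Function.Surjective π)
    (v : ι → n → R) (hv : LinearIndependent F fun i => π ∘ v i) :
    ∃ (P : Matrix n n R) (f : ι → n), Function.Injective f ∧ (∀ i, P (f i) = v i) ∧
      π P.det ≠ 0 := by
  classical
  let b := Module.Basis.sumExtend hv
  let e := b.indexEquiv (Pi.basisFun F n)
  have hb : ∀ i, b (Sum.inl i) = π ∘ v i := fun i => by
    simp only [b, Module.Basis.sumExtend, Module.Basis.reindex_apply, Module.Basis.extend_apply_self]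
    rfl
  let P : Matrix n n R := fun k =>
    Sum.elim v (fun j c => Function.surjInv hπ (b (Sum.inr j) c)) (e.symm k)
  have hP : ∀ k, π ∘ P k = b (e.symm k) := by
    intro k
    rcases h : e.symm k with i | j
    · simp [P, h, hb]
    · funext c
      simp [P, h, Function.surjInv_eq hπ]
  refine ⟨P, fun i => e (Sum.inl i), e.injective.comp Sum.inl_injective,
    fun i => by simp [P], ?_⟩
  have hrows : LinearIndependent F (P.map π).row := by
    have : (P.map π).row = b ∘ e.symm := funext hP
    rw [this]
    exact b.linearIndependent.comp _ e.symm.injective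
  rw [linearIndependent_rows_iff_isUnit, isUnit_iff_isUnit_det] at hrows
  rw [RingHom.map_det]
  exact hrows.ne_zero

/-- If independent vectors are annihilated modulo `p` by `M` from the left, then in a basis
containing them the corresponding rows of `M` can be divided by `p`. -/
theorem exists_det_mul_det_eq_pow_mul [Fintype ι] [IsDomain R] (π : R →+* F) (hπ : Function.Surjective π)
    {p : R} (hp : p ≠ 0) (M : Matrix n n R)
    (v : ι → n → R) (hv : LinearIndependent F fun i => π ∘ v i)
    (hM : ∀ i j, p ∣ (v i ᵥ* M) j) :
    ∃ P N : Matrix n n R, π P.det ≠ 0 ∧ P.det * M.det = p ^ Fintype.card ι * N.det ∧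
      ∀ w, (∀ j, p ∣ (M *ᵥ w) j) → (∀ i, p ^ 2 ∣ v i ⬝ᵥ M *ᵥ w) → ∀ k, p ∣ (N *ᵥ w) k := by
  classical
  obtain ⟨P, f, hf, hPf, hP⟩ := exists_matrix_rows_of_linearIndependent π hπ v hv
  choose c hc using hM
  let N : Matrix n n R := fun k => if h : ∃ i, f i = k then c h.choose else (P * M) k
  let D : n → R := fun k => if ∃ i, f i = k then p else 1
  have hrow : ∀ i, (P * M) (f i) = v i ᵥ* M := fun i => by
    rw [← hPf]; rfl
  have hPM : P * M = diagonal D * N := by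
    ext k j
    rw [diagonal_mul]
    by_cases h : ∃ i, f i = k
    · have hk := congrFun (hrow h.choose) j
      rw [h.choose_spec] at hk
      simp [D, N, h, hk, hc]
    · simp [D, N, h]
  refine ⟨P, N, hP, ?_, ?_⟩
  · rw [← det_mul, hPM, det_mul, det_diagonal]
    congr 1
    have : (Finset.univ.filter fun k => ∃ i, f i = k) = Finset.univ.image f := by
      ext k; simp
    simp only [D, Finset.prod_ite, Finset.prod_const, one_pow, mul_one, this]
    rw [Finset.card_image_of_injective _ hf, Finset.card_univ]
  · intro w hw hvw k
    by_cases h : ∃ i, f i = k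
    · have h1 : p * (N *ᵥ w) k = v h.choose ⬝ᵥ M *ᵥ w := by
        rw [dotProduct_mulVec]
        simp only [mulVec, dotProduct, Finset.mul_sum, N, dif_pos h]
        exact Finset.sum_congr rfl fun j _ => by rw [hc]; ring
      have h2 := hvw h.choose
      rw [← h1, pow_two] at h2
      exact (mul_dvd_mul_iff_left hp).1 h2
    · have h1 : (N *ᵥ w) k = (P *ᵥ (M *ᵥ w)) k := by
        rw [mulVec_mulVec]
        simp only [mulVec, N, dif_neg h]
      rw [h1]
      exact Finset.dvd_sum fun j _ => (hw j).mul_left _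

theorem pow_dvd_det [Fintype ι] [IsDomain R] (π : R →+* F) (hπ : Function.Surjective π)
    {p : R} (hp : Prime p) (hker : ∀ a, π a = 0 ↔ p ∣ a) (M : Matrix n n R)
    (v : ι → n → R) (hv : LinearIndependent F fun i => π ∘ v i)
    (hM : ∀ i j, p ∣ (v i ᵥ* M) j) : p ^ Fintype.card ι ∣ M.det := by
  obtain ⟨P, N, hP, hdet, -⟩ := exists_det_mul_det_eq_pow_mul π hπ hp.ne_zero M v hv hM
  rw [Ne, hker] at hP
  exact hp.pow_dvd_of_dvd_mul_left _ hP ⟨_, hdet⟩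

/-- The extra factor `p` comes from a vector `w` that stays in the kernel modulo `p` after the rows
of `M` annihilated modulo `p` have been divided by `p`. -/
theorem pow_succ_dvd_det [Fintype ι] [IsDomain R] (π : R →+* F) (hπ : Function.Surjective π)
    {p : R} (hp : Prime p) (hker : ∀ a, π a = 0 ↔ p ∣ a) (M : Matrix n n R)
    (v : ι → n → R) (hv : LinearIndependent F fun i => π ∘ v i)
    (hM : ∀ i j, p ∣ (v i ᵥ* M) j)
    (w : n → R) (hw : π ∘ w ≠ 0) (hMw : ∀ j, p ∣ (M *ᵥ w) j)
    (hvw : ∀ i, p ^ 2 ∣ v i ⬝ᵥ M *ᵥ w) : p ^ (Fintype.card ι + 1) ∣ M.det := by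
  obtain ⟨P, N, hP, hdet, hN⟩ := exists_det_mul_det_eq_pow_mul π hπ hp.ne_zero M v hv hM
  have hN0 : π N.det = 0 := by
    rw [RingHom.map_det]
    refine exists_mulVec_eq_zero_iff.1 ⟨π ∘ w, hw, ?_⟩
    funext k
    have := (hker _).2 (hN w hMw hvw k)
    rwa [RingHom.map_mulVec] at this
  rw [Ne, hker] at hP
  refine hp.pow_dvd_of_dvd_mul_left _ hP ?_
  rw [hdet, pow_succ]
  exact mul_dvd_mul_left _ ((hker _).1 hN0)

end Divisibility

/-! ### Isotropic vectors and the characteristic polynomial -/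

section Field

variable {F n : Type*} [Field F] [Fintype n] [DecidableEq n]

theorem aeval_mul_mulVec {R : Type*} [CommRing R] (A : Matrix n n R) (f g : R[X]) (v : n → R) :
    aeval A (f * g) *ᵥ v = aeval A f *ᵥ (aeval A g *ᵥ v) := by
  rw [map_mul, mulVec_mulVec]

theorem charmatrix_mulVec (A : Matrix n n F) (w : n → F[X]) :
    charmatrix A *ᵥ w = fun i => X * w i - (A.map C *ᵥ w) i := by
  funext i
  simp [charmatrix, sub_mulVec, RingHom.mapMatrix_apply, ← smul_one_eq_diagonal, smul_mulVec]

/-- Division of `f(x) - f(A)` by `x - A`, applied to a vector `v`. The quotient lies in the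
`F[x]`-span of the orbit of `v` under `F[A]`, so it is orthogonal to whatever that orbit is
orthogonal to. -/
theorem exists_charmatrix_mulVec_eq (A : Matrix n n F) (v : n → F) (f : F[X]) :
    ∃ w : n → F[X],
      charmatrix A *ᵥ w = (fun i => f * C (v i) - C ((aeval A f *ᵥ v) i)) ∧
      ∀ y : n → F, (∀ g : F[X], y ⬝ᵥ aeval A g *ᵥ v = 0) → (C ∘ y) ⬝ᵥ w = 0 := by
  induction f using Polynomial.induction_on' with
  | add f g hf hg =>
    obtain ⟨w, hw, hw'⟩ := hf
    obtain ⟨u, hu, hu'⟩ := hg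
    refine ⟨w + u, ?_, fun y hy => by rw [dotProduct_add, hw' y hy, hu' y hy, add_zero]⟩
    rw [mulVec_add, hw, hu]
    funext i
    simp only [Pi.add_apply, map_add, add_mulVec]
    ring
  | monomial k a =>
    induction k with
    | zero =>
      refine ⟨0, ?_, fun y _ => by simp⟩
      funext i
      simp [Algebra.algebraMap_eq_smul_one, smul_mulVec]
    | succ k ih =>
      obtain ⟨w, hw, hw'⟩ := ih
      refine ⟨fun i => X * w i + C ((aeval A (monomial k a) *ᵥ v) i), ?_, fun y hy => ?_⟩
      · have e1 : (fun i => X * w i + C ((aeval A (monomial k a) *ᵥ v) i)) =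
            (X : F[X]) • w + C ∘ (aeval A (monomial k a) *ᵥ v) := rfl
        have e2 : aeval A (monomial (k + 1) a) *ᵥ v = A *ᵥ (aeval A (monomial k a) *ᵥ v) := by
          rw [mulVec_mulVec, aeval_monomial, aeval_monomial, pow_succ', ← mul_assoc, ← mul_assoc,
            Algebra.commutes]
        rw [e1, mulVec_add, mulVec_smul, hw, e2, charmatrix_mulVec]
        funext i
        have e3 : (A.map C *ᵥ (C ∘ (aeval A (monomial k a) *ᵥ v))) i =
            C ((A *ᵥ (aeval A (monomial k a) *ᵥ v)) i) := by
          rw [RingHom.map_mulVec]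
        simp only [Pi.add_apply, Pi.smul_apply, smul_eq_mul, e3, Function.comp_apply]
        rw [← X_mul_monomial]
        ring
      · have e1 : (fun i => X * w i + C ((aeval A (monomial k a) *ᵥ v) i)) =
            (X : F[X]) • w + C ∘ (aeval A (monomial k a) *ᵥ v) := rfl
        rw [e1, dotProduct_add, dotProduct_smul, hw' y hy, ← RingHom.map_dotProduct, hy]
        simp

/-- If a symmetric matrix has a nonzero vector `v` killed by the irreducible polynomial `φ(A)` and
orthogonal to its own orbit under `F[A]`, then `φ²` divides the characteristic polynomial. Over
`F[x]/(φ)` the vector `v` gives an isotropic eigenvector of `A`. -/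
theorem sq_dvd_charpoly (A : Matrix n n F) (hA : A.IsSymm) {φ : F[X]} (hφ : Irreducible φ)
    {v : n → F} (hv : v ≠ 0) (hφv : aeval A φ *ᵥ v = 0)
    (hiso : ∀ g : F[X], v ⬝ᵥ aeval A g *ᵥ v = 0) : φ ^ 2 ∣ A.charpoly := by
  have : Fact (Irreducible φ) := ⟨hφ⟩
  obtain ⟨w, hw, hw'⟩ := exists_charmatrix_mulVec_eq A v φ
  rw [hφv] at hw
  simp only [Pi.zero_apply, map_zero, sub_zero] at hw
  have hker : ∀ a, AdjoinRoot.mk φ a = 0 ↔ φ ∣ a := fun a => AdjoinRoot.mk_eq_zero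
  -- `w` is nonzero modulo `φ`: otherwise `v = (x - A) u`, and substituting `A` for `x` kills `v`.
  have hw0 : AdjoinRoot.mk φ ∘ w ≠ 0 := by
    intro h0
    have h1 : ∀ i, φ ∣ w i := fun i => (hker _).1 (congrFun h0 i)
    choose u hu using h1
    have hu1 : charmatrix A *ᵥ u = C ∘ v := by
      have h2 : w = φ • u := funext hu
      rw [h2, mulVec_smul] at hw
      funext i
      exact mul_left_cancel₀ hφ.ne_zero (congrFun hw i)
    apply hv
    let ev : (n → F[X]) → (n → F) := fun z => ∑ j, (aeval A (z j)).col j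
    have hev : ∀ z i, ev z i = ∑ j, (aeval A (z j)) i j := fun z i => by
      simp [ev, Finset.sum_apply, col]
    have hvev : ev (C ∘ v) = v := by
      funext i
      rw [hev]
      simp [Matrix.algebraMap_matrix_apply]
    rw [← hvev, ← hu1]
    funext i
    rw [hev]
    have h3 : ∀ j, (charmatrix A *ᵥ u) j = X * u j - ∑ k, C (A j k) * u k := fun j => by
      rw [charmatrix_mulVec]
      simp [mulVec, dotProduct]
    simp only [h3, map_sub, map_sum, map_mul, aeval_X, aeval_C, Matrix.sub_apply,
      Finset.sum_sub_distrib, Matrix.sum_apply, Algebra.algebraMap_eq_smul_one, smul_mul_assoc,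
      one_mul, Matrix.smul_apply, smul_eq_mul, Pi.zero_apply]
    rw [sub_eq_zero, Finset.sum_comm]
    refine Finset.sum_congr rfl fun j _ => ?_
    have hcomm : A * aeval A (u j) = aeval A (u j) * A := by
      have := (Commute.all X (u j)).map (aeval A : F[X] →ₐ[F] Matrix n n F)
      simpa using this.eq
    rw [hcomm, mul_apply]
    refine Finset.sum_congr rfl fun k _ => ?_
    rw [mul_comm, hA.apply]
  have hsymm : (charmatrix A)ᵀ = charmatrix A := by
    rw [← charmatrix_transpose, hA.eq]
  have hdvd : ∀ j, φ ∣ (charmatrix A *ᵥ w) j := fun j => by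
    rw [hw]; exact dvd_mul_right _ _
  have key := pow_succ_dvd_det (AdjoinRoot.mk φ) AdjoinRoot.mk_surjective hφ.prime hker
    (charmatrix A) (fun _ : Unit => w) (linearIndependent_unique_iff.2 hw0)
    (fun _ j => by rw [← mulVec_transpose, hsymm]; exact hdvd j) w hw0 hdvd
    (fun _ => by
      have h4 : w ⬝ᵥ charmatrix A *ᵥ w = φ * ((C ∘ v) ⬝ᵥ w) := by
        rw [hw]
        simp only [dotProduct, Finset.mul_sum, Function.comp]
        exact Finset.sum_congr rfl fun i _ => by ring
      rw [h4, hw' v hiso, mul_zero]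
      exact dvd_zero _)
  simpa [charpoly] using key

/-- A nonzero invariant subspace contains a vector whose annihilator is generated by an irreducible
polynomial. -/
theorem exists_irreducible_aeval_mulVec_eq_zero (A : Matrix n n F) (V : Submodule F (n → F))
    (hV : V ≠ ⊥) (hAV : ∀ v ∈ V, A *ᵥ v ∈ V) :
    ∃ φ : F[X], φ.Monic ∧ Irreducible φ ∧ ∃ v ∈ V, v ≠ 0 ∧ aeval A φ *ᵥ v = 0 := by
  classical
  have hpoly : ∀ (g : F[X]), ∀ v ∈ V, aeval A g *ᵥ v ∈ V := by
    intro g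
    induction g using Polynomial.induction_on' with
    | add f g hf hg =>
      intro v hv
      rw [map_add, add_mulVec]
      exact V.add_mem (hf v hv) (hg v hv)
    | monomial k a =>
      intro v hv
      rw [aeval_monomial, Algebra.algebraMap_eq_smul_one, smul_mul_assoc, one_mul, smul_mulVec]
      refine V.smul_mem _ ?_
      induction k generalizing v with
      | zero => simpa using hv
      | succ k ih =>
        rw [pow_succ, ← mulVec_mulVec]
        exact ih _ (hAV v hv)
  let Q : ℕ → Prop := fun d => ∃ φ : F[X], φ.Monic ∧ φ.natDegree = d ∧
    ∃ v ∈ V, v ≠ 0 ∧ aeval A φ *ᵥ v = 0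
  have hQ : ∃ d, Q d := by
    obtain ⟨v, hv, hv0⟩ := V.ne_bot_iff.1 hV
    exact ⟨_, A.charpoly, A.charpoly_monic, rfl, v, hv, hv0, by
      rw [aeval_self_charpoly, zero_mulVec]⟩
  obtain ⟨φ, hmon, hdeg, v, hv, hv0, hφv⟩ := Nat.find_spec hQ
  have hmin : ∀ g : F[X], g.Monic → ∀ u ∈ V, u ≠ 0 → aeval A g *ᵥ u = 0 →
      φ.natDegree ≤ g.natDegree := fun g hg u hu hu0 hgu => by
    rw [hdeg]
    exact Nat.find_min' hQ ⟨g, hg, rfl, u, hu, hu0, hgu⟩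
  refine ⟨φ, hmon, ?_, v, hv, hv0, hφv⟩
  have hne : φ ≠ 1 := by
    rintro rfl
    exact hv0 (by simpa using hφv)
  refine (hmon.irreducible_iff_natDegree).2 ⟨hne, fun f g hf hg hfg => ?_⟩
  have hd : φ.natDegree = f.natDegree + g.natDegree := by rw [← hfg, hf.natDegree_mul hg]
  rw [← hfg, aeval_mul_mulVec] at hφv
  by_cases h0 : aeval A g *ᵥ v = 0
  · have := hmin g hg v hv hv0 h0
    exact Or.inl (by omega)
  · have := hmin f hf _ (hpoly g v hv) h0 hφv
    exact Or.inr (by omega)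

theorem dvd_of_aeval_mulVec_eq_zero (A : Matrix n n F) {φ : F[X]} (hφ : Irreducible φ)
    {v : n → F} (hv : v ≠ 0) (hφv : aeval A φ *ᵥ v = 0) {g : F[X]} (hg : aeval A g *ᵥ v = 0) :
    φ ∣ g := by
  by_contra h
  obtain ⟨a, b, hab⟩ := (hφ.coprime_iff_not_dvd).2 h
  apply hv
  have : aeval A (a * φ + b * g) *ᵥ v = 0 := by
    rw [map_add, add_mulVec, aeval_mul_mulVec, aeval_mul_mulVec, hφv, hg]
    simp
  simpa [hab] using this

theorem aeval_ofFn_mulVec {R : Type*} [CommRing R] [DecidableEq R] (A : Matrix n n R) (v : n → R)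
    {d : ℕ} (c : Fin d → R) :
    aeval A (ofFn d c) *ᵥ v = ∑ i, c i • (A ^ (i : ℕ) *ᵥ v) := by
  rw [ofFn_eq_sum_monomial, map_sum, sum_mulVec]
  refine Finset.sum_congr rfl fun i _ => ?_
  rw [aeval_monomial, Algebra.algebraMap_eq_smul_one, smul_mul_assoc, one_mul, smul_mulVec]

theorem linearIndependent_pow_mulVec (A : Matrix n n F) {φ : F[X]} (hφ : Irreducible φ)
    {v : n → F} (hv : v ≠ 0) (hφv : aeval A φ *ᵥ v = 0) :
    LinearIndependent F fun i : Fin φ.natDegree => A ^ (i : ℕ) *ᵥ v := by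
  classical
  rw [Fintype.linearIndependent_iff]
  intro c hc i
  rw [← aeval_ofFn_mulVec] at hc
  have h0 := eq_zero_of_dvd_of_degree_lt (dvd_of_aeval_mulVec_eq_zero A hφ hv hφv hc)
    ((ofFn_degree_lt c).trans_eq (degree_eq_natDegree hφ.ne_zero).symm)
  have := ofFn_coeff_eq_val_of_lt c i.2
  rw [h0] at this
  simpa using this.symm

end Field

/-! ### Integral intertwiners modulo a prime -/

section Reduction

variable {R S n : Type*} [CommRing R] [CommRing S] [Fintype n] [DecidableEq n]

theorem map_aeval (π : R →+* S) (A : Matrix n n R) (f : R[X]) :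
    (aeval A f).map π = aeval (A.map π) (f.map π) := by
  have h : (π.mapMatrix.comp (aeval A : R[X] →ₐ[R] Matrix n n R).toRingHom) =
      (aeval (A.map π) : S[X] →ₐ[S] Matrix n n S).toRingHom.comp (mapRingHom π) := by
    ext a i j
    · simp [Matrix.algebraMap_matrix_apply, apply_ite π]
    · simp
  exact DFunLike.congr_fun h f

theorem comp_aeval_mulVec (π : R →+* S) (A : Matrix n n R) (f : R[X]) (v : n → R) :
    π ∘ (aeval A f *ᵥ v) = aeval (A.map π) (f.map π) *ᵥ (π ∘ v) := by
  funext i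
  rw [← map_aeval, Function.comp_apply, RingHom.map_mulVec]

theorem aeval_add_mulVec (A J : Matrix n n R) (v : n → R)
    (h : ∀ k : ℕ, J *ᵥ (A ^ k *ᵥ v) = 0) (f : R[X]) :
    aeval (A + J) f *ᵥ v = aeval A f *ᵥ v := by
  have hpow : ∀ k : ℕ, (A + J) ^ k *ᵥ v = A ^ k *ᵥ v := by
    intro k
    induction k with
    | zero => simp
    | succ k ih =>
      rw [pow_succ', ← mulVec_mulVec, ih, add_mulVec, h, add_zero, mulVec_mulVec, ← pow_succ']
  induction f using Polynomial.induction_on' with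
  | add f g hf hg => rw [map_add, map_add, add_mulVec, add_mulVec, hf, hg]
  | monomial k a =>
    simp only [aeval_monomial, Algebra.algebraMap_eq_smul_one, smul_mul_assoc, one_mul, smul_mulVec,
      hpow]

theorem isSymm_aeval {A : Matrix n n R} (hA : A.IsSymm) (f : R[X]) : (aeval A f).IsSymm := by
  induction f using Polynomial.induction_on' with
  | add f g hf hg => rw [map_add]; exact hf.add hg
  | monomial k a =>
    rw [aeval_monomial, Algebra.algebraMap_eq_smul_one, smul_mul_assoc, one_mul]
    exact (hA.pow k).smul a

theorem dotProduct_mulVec_comm {R n : Type*} [CommRing R] [Fintype n] {A : Matrix n n R} (hA : A.IsSymm) (v w : n → R) :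
    v ⬝ᵥ A *ᵥ w = A *ᵥ v ⬝ᵥ w := by
  rw [dotProduct_mulVec, ← mulVec_transpose, hA.eq]

end Reduction

section ZMod

variable {p : ℕ}

theorem castRingHom_eq_zero_iff (a : ℤ) : Int.castRingHom (ZMod p) a = 0 ↔ (p : ℤ) ∣ a := by
  simpa using ZMod.intCast_zmod_eq_zero_iff_dvd a p

theorem castRingHom_surjective : Function.Surjective (Int.castRingHom (ZMod p)) :=
  ZMod.intCast_surjective

theorem prime_cast [Fact p.Prime] : Prime (p : ℤ) := Nat.prime_iff_prime_int.1 Fact.out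

end ZMod

variable {n : ℕ}

/-- `U` is `l` times a (rational) orthogonal matrix `Q` with `Q e = e` and `A Q = Q B`, where `A` is
symmetric. The identity `Qᵀ e = e` follows from the others if `l ≠ 0`. -/
structure IsIntertwiner (A B U : Matrix (Fin n) (Fin n) ℤ) (l : ℤ) : Prop where
  symm : A.IsSymm
  comm : A * U = U * B
  gram : Uᵀ * U = l ^ 2 • (1 : Matrix (Fin n) (Fin n) ℤ)
  mulVec_one : U *ᵥ 1 = l • 1
  transpose_mulVec_one : Uᵀ *ᵥ 1 = l • 1

theorem allOne_isSymm : (allOne n).IsSymm := by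
  ext i j; simp [allOne]

namespace IsIntertwiner

variable {A B U : Matrix (Fin n) (Fin n) ℤ} {l : ℤ}

theorem add_allOne (h : IsIntertwiner A B U l) :
    IsIntertwiner (A + allOne n) (B + allOne n) U l where
  symm := h.symm.add allOne_isSymm
  comm := by
    rw [add_mul, mul_add, h.comm]
    congr 1
    ext i j
    have h1 := congrFun h.mulVec_one i
    have h2 := congrFun h.transpose_mulVec_one j
    simp only [mulVec, dotProduct, transpose_apply, Pi.one_apply, mul_one, Pi.smul_apply,
      smul_eq_mul] at h1 h2
    simp [allOne, mul_apply, h1, h2]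
  gram := h.gram
  mulVec_one := h.mulVec_one
  transpose_mulVec_one := h.transpose_mulVec_one

theorem aeval_mul (h : IsIntertwiner A B U l) (f : ℤ[X]) : aeval A f * U = U * aeval B f := by
  induction f using Polynomial.induction_on' with
  | add f g hf hg => rw [map_add, map_add, add_mul, mul_add, hf, hg]
  | monomial k a =>
    have : A ^ k * U = U * B ^ k := by
      induction k with
      | zero => simp
      | succ k ih => rw [pow_succ, mul_assoc, h.comm, ← mul_assoc, ih, mul_assoc, ← pow_succ]
    simp only [aeval_monomial, Algebra.algebraMap_eq_smul_one, smul_mul_assoc, one_mul,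
      mul_smul_comm, this]

theorem dotProduct_aeval (h : IsIntertwiner A B U l) (f : ℤ[X]) (z z' : Fin n → ℤ) :
    (U *ᵥ z) ⬝ᵥ aeval A f *ᵥ (U *ᵥ z') = l ^ 2 * (z ⬝ᵥ aeval B f *ᵥ z') := by
  rw [mulVec_mulVec, h.aeval_mul, ← mulVec_mulVec, dotProduct_mulVec, ← mulVec_transpose,
    mulVec_mulVec, h.gram, smul_mulVec, one_mulVec, smul_dotProduct, smul_eq_mul]

theorem one_dotProduct_aeval (h : IsIntertwiner A B U l) (f : ℤ[X]) (z : Fin n → ℤ) :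
    1 ⬝ᵥ aeval A f *ᵥ (U *ᵥ z) = l * (1 ⬝ᵥ aeval B f *ᵥ z) := by
  rw [mulVec_mulVec, h.aeval_mul, ← mulVec_mulVec, dotProduct_mulVec, ← mulVec_transpose,
    h.transpose_mulVec_one, smul_dotProduct, smul_eq_mul]

variable {p : ℕ} [Fact p.Prime]

local notation "π" => Int.castRingHom (ZMod p)

/-- The column space of `U` modulo `p` is invariant under `A`. -/
theorem exists_irreducible (h : IsIntertwiner A B U l) (hU : U.map π ≠ 0) :
    ∃ φ : (ZMod p)[X], φ.Monic ∧ Irreducible φ ∧ ∃ z : Fin n → ℤ,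
      π ∘ (U *ᵥ z) ≠ 0 ∧ aeval (A.map π) φ *ᵥ (π ∘ (U *ᵥ z)) = 0 := by
  have hcomm : A.map π * U.map π = U.map π * B.map π := by
    rw [← Matrix.map_mul, ← Matrix.map_mul, h.comm]
  obtain ⟨φ, hmon, hirr, v, ⟨y, rfl⟩, hv0, hv⟩ :=
    exists_irreducible_aeval_mulVec_eq_zero (A.map π) (LinearMap.range (U.map π).mulVecLin)
      (by
        rw [Ne, LinearMap.range_eq_bot]
        intro h0
        exact hU (toLin'.map_eq_zero_iff.1 (by rw [toLin'_apply', h0])))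
      (by
        rintro _ ⟨y, rfl⟩
        refine ⟨B.map π *ᵥ y, ?_⟩
        simp only [mulVecLin_apply, mulVec_mulVec, hcomm])
  have hy : π ∘ (Function.surjInv castRingHom_surjective ∘ y) = y :=
    _root_.funext fun j => Function.surjInv_eq castRingHom_surjective (y j)
  have hz : π ∘ (U *ᵥ (Function.surjInv castRingHom_surjective ∘ y)) = (U.map π) *ᵥ y := by
    funext i
    rw [Function.comp_apply, RingHom.map_mulVec, hy]
  exact ⟨φ, hmon, hirr, _, by rwa [hz], by rwa [hz]⟩

theorem castRingHom_dotProduct_aeval (h : IsIntertwiner A B U l) (hl : (p : ℤ) ∣ l)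
    (g : (ZMod p)[X]) (z : Fin n → ℤ) :
    (π ∘ (U *ᵥ z)) ⬝ᵥ aeval (A.map π) g *ᵥ (π ∘ (U *ᵥ z)) = 0 := by
  obtain ⟨f, rfl⟩ := map_surjective π castRingHom_surjective g
  rw [← comp_aeval_mulVec, ← RingHom.map_dotProduct, h.dotProduct_aeval, castRingHom_eq_zero_iff]
  exact (dvd_pow hl two_ne_zero).mul_right _

theorem one_dotProduct_castRingHom_aeval (h : IsIntertwiner A B U l) (hl : (p : ℤ) ∣ l)
    (g : (ZMod p)[X]) (z : Fin n → ℤ) :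
    1 ⬝ᵥ aeval (A.map π) g *ᵥ (π ∘ (U *ᵥ z)) = 0 := by
  obtain ⟨f, rfl⟩ := map_surjective π castRingHom_surjective g
  have h1 : (1 : Fin n → ZMod p) = π ∘ (1 : Fin n → ℤ) := by funext i; simp
  rw [← comp_aeval_mulVec, h1, ← RingHom.map_dotProduct, h.one_dotProduct_aeval,
    castRingHom_eq_zero_iff]
  exact hl.mul_right _

/-- On the column space of `U` modulo `p` the matrices `A` and `A + J` agree. -/
theorem aeval_add_allOne_mulVec (h : IsIntertwiner A B U l) (hl : (p : ℤ) ∣ l)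
    (g : (ZMod p)[X]) (z : Fin n → ℤ) :
    aeval ((A + allOne n).map π) g *ᵥ (π ∘ (U *ᵥ z)) =
      aeval (A.map π) g *ᵥ (π ∘ (U *ᵥ z)) := by
  rw [Matrix.map_add _ (map_add π)]
  refine aeval_add_mulVec _ _ _ (fun k => ?_) g
  have := h.one_dotProduct_castRingHom_aeval hl (X ^ k) z
  rw [aeval_X_pow] at this
  funext i
  refine Eq.trans ?_ this
  simp [allOne, mulVec, dotProduct]

theorem sq_dvd_charpoly_map (h : IsIntertwiner A B U l) (hl : (p : ℤ) ∣ l)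
    {φ : (ZMod p)[X]} (hφ : Irreducible φ) {z : Fin n → ℤ} (hz : π ∘ (U *ᵥ z) ≠ 0)
    (hφz : aeval (A.map π) φ *ᵥ (π ∘ (U *ᵥ z)) = 0) : φ ^ 2 ∣ A.charpoly.map π := by
  rw [← charpoly_map]
  exact sq_dvd_charpoly _ (h.symm.map _) hφ hz hφz
    fun g => h.castRingHom_dotProduct_aeval hl g z

/-- The vectors `Aⁱ v`, `i < deg φ`, are annihilated by `f(A)` modulo `p`, and the bilinear form
defined by `f(A)` vanishes on them modulo `p²`. -/
theorem pow_succ_dvd_det_aeval (h : IsIntertwiner A B U l) (hl : (p : ℤ) ∣ l)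
    {φ : (ZMod p)[X]} (hφ : Irreducible φ) {z : Fin n → ℤ} (hz : π ∘ (U *ᵥ z) ≠ 0)
    (hφz : aeval (A.map π) φ *ᵥ (π ∘ (U *ᵥ z)) = 0) {f : ℤ[X]} (hf : φ ∣ f.map π) :
    (p : ℤ) ^ (φ.natDegree + 1) ∣ (aeval A f).det := by
  have hfz : ∀ g : (ZMod p)[X],
      aeval (A.map π) (f.map π) *ᵥ (aeval (A.map π) g *ᵥ (π ∘ (U *ᵥ z))) = 0 := by
    intro g
    obtain ⟨q, hq⟩ := hf
    rw [← aeval_mul_mulVec, hq, show φ * q * g = (q * g) * φ by ring, aeval_mul_mulVec, hφz,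
      mulVec_zero]
  have hdvd : ∀ k j, (p : ℤ) ∣ (aeval A f *ᵥ (A ^ k *ᵥ (U *ᵥ z))) j := by
    intro k j
    have := hfz (X ^ k)
    rw [← castRingHom_eq_zero_iff]
    have h1 := comp_aeval_mulVec π A (f * X ^ k) (U *ᵥ z)
    rw [Polynomial.map_mul, Polynomial.map_pow, map_X, aeval_mul_mulVec, aeval_mul_mulVec, this,
      aeval_X_pow] at h1
    exact congrFun h1 j
  have key := pow_succ_dvd_det π castRingHom_surjective prime_cast castRingHom_eq_zero_iff
    (aeval A f) (fun i : Fin φ.natDegree => A ^ (i : ℕ) *ᵥ (U *ᵥ z))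
    (by
      convert linearIndependent_pow_mulVec (A.map π) hφ hz hφz using 2 with i
      have := comp_aeval_mulVec π A (X ^ (i : ℕ)) (U *ᵥ z)
      rwa [Polynomial.map_pow, map_X, aeval_X_pow, aeval_X_pow] at this)
    (fun i j => by
      rw [← mulVec_transpose, (isSymm_aeval h.symm f).eq]
      exact hdvd _ j)
    (U *ᵥ z) hz
    (fun j => by simpa using hdvd 0 j)
    (fun i => by
      have e1 : A ^ (i : ℕ) *ᵥ (U *ᵥ z) = U *ᵥ (aeval B (X ^ (i : ℕ) : ℤ[X]) *ᵥ z) := by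
        rw [mulVec_mulVec, mulVec_mulVec, ← h.aeval_mul, aeval_X_pow]
      rw [e1, h.dotProduct_aeval]
      exact (pow_dvd_pow_of_dvd hl 2).mul_right _)
  simpa using key

end IsIntertwiner

/-! ### The discriminant as a determinant -/

theorem det_aeval_eq_resultant {K : Type*} [Field K] {n : Type*} [Fintype n] [DecidableEq n]
    (A : Matrix n n K) {g : K[X]} (hg : g.Splits) :
    (aeval A g).det = resultant A.charpoly g := by
  have hdet : ∀ b : K, (aeval A (X - C b)).det = (-1) ^ Fintype.card n * A.charpoly.eval b := by
    intro b
    rw [eval_charpoly, ← det_neg, neg_sub, map_sub, aeval_X, aeval_C]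
    rfl
  have hprod : ∀ s : Multiset K, (aeval A (s.map fun b => X - C b).prod).det =
      (-1) ^ (Fintype.card n * s.card) * (s.map fun b => A.charpoly.eval b).prod := by
    intro s
    induction s using Multiset.induction_on with
    | empty => simp
    | cons b s ih =>
      simp only [Multiset.map_cons, Multiset.prod_cons, map_mul, det_mul, ih, hdet,
        Multiset.card_cons]
      ring
  rw [resultant_comm, resultant_eq_prod_eval _ _ _ le_rfl hg, charpoly_natDegree_eq_dim,
    hg.natDegree_eq_card_roots]
  nth_rewrite 1 [hg.eq_prod_roots]
  rw [map_mul, det_mul, hprod, aeval_C, Matrix.algebraMap_eq_diagonal, det_diagonal]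
  simp
  ring

/-- Up to sign, the discriminant of the characteristic polynomial is `det χ'(A)`. -/
theorem dvd_discr_charpoly {n : ℕ} (hn : 0 < n) (A : Matrix (Fin n) (Fin n) ℤ) {d : ℤ}
    (hd : d ∣ (aeval A (derivative A.charpoly)).det) : d ∣ A.charpoly.discr := by
  have hnat : A.charpoly.natDegree = n := by simp
  have hres : (aeval A (derivative A.charpoly)).det =
      resultant A.charpoly (derivative A.charpoly) A.charpoly.natDegree
        (A.charpoly.natDegree - 1) := by
    apply (Int.castRingHom ℂ).injective_int
    have h1 := det_aeval_eq_resultant (A.map (Int.castRingHom ℂ))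
      (IsAlgClosed.splits ((derivative A.charpoly).map (Int.castRingHom ℂ)))
    rw [RingHom.map_det, RingHom.mapMatrix_apply, map_aeval, h1, ← resultant_map_map, charpoly_map]
    congr 1
    · exact natDegree_map_eq_of_injective (RingHom.injective_int _) _
    · rw [natDegree_map_eq_of_injective (RingHom.injective_int _), natDegree_derivative]
  rw [hres, resultant_deriv (natDegree_pos_iff_degree_pos.1 (by omega)),
    A.charpoly_monic.leadingCoeff, mul_one] at hd
  exact (((isUnit_one.neg).pow _).dvd_mul_left).1 hd

/-! ### The walk matrix at a prime dividing the level -/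

section Walk

variable {R : Type*} [CommRing R] {n : ℕ}

/-- The walk matrix `[e, Ae, …, Aⁿ⁻¹e]` of an arbitrary square matrix `A`. -/
def walk (A : Matrix (Fin n) (Fin n) R) : Matrix (Fin n) (Fin n) R :=
  Matrix.of fun i j => (A ^ (j : ℕ) *ᵥ 1) i

theorem walk_mulVec [DecidableEq R] (A : Matrix (Fin n) (Fin n) R) (c : Fin n → R) :
    walk A *ᵥ c = aeval A (ofFn n c) *ᵥ 1 := by
  rw [aeval_ofFn_mulVec]
  funext i
  simp [walk, mulVec, dotProduct, mul_comm]

theorem map_ofFn {S : Type*} [CommRing S] [DecidableEq R] [DecidableEq S] (f : R →+* S)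
    (c : Fin n → R) : (ofFn n c).map f = ofFn n (f ∘ c) := by
  simp [ofFn_eq_sum_monomial, Polynomial.map_sum]

theorem vecMul_walk (A : Matrix (Fin n) (Fin n) R) (v : Fin n → R) (j : Fin n) :
    (v ᵥ* walk A) j = v ⬝ᵥ A ^ (j : ℕ) *ᵥ 1 := rfl

theorem walk_map {S : Type*} [CommRing S] (f : R →+* S) (A : Matrix (Fin n) (Fin n) R) :
    (walk A).map f = walk (A.map f) := by
  ext i j
  have := congrFun (comp_aeval_mulVec f A (X ^ (j : ℕ)) 1) i
  rw [aeval_X_pow, Polynomial.map_pow, map_X, aeval_X_pow] at this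
  have h1 : f ∘ (1 : Fin n → R) = 1 := by funext i; simp
  rw [h1] at this
  exact this

end Walk

theorem exists_generator_annihilator {F : Type*} [Field F] {m : Type*} [Fintype m] [DecidableEq m]
    (A : Matrix m m F) (e : m → F) :
    ∃ q : F[X], ∀ g, aeval A g *ᵥ e = 0 ↔ q ∣ g := by
  let I : Ideal F[X] :=
    { carrier := {g | aeval A g *ᵥ e = 0}
      add_mem' := fun {a b} ha hb => by
        simp only [Set.mem_ofPred_eq] at ha hb ⊢
        rw [map_add, add_mulVec, ha, hb, add_zero]
      zero_mem' := by simp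
      smul_mem' := fun c x hx => by
        simp only [Set.mem_ofPred_eq, smul_eq_mul] at hx ⊢
        rw [aeval_mul_mulVec, hx, mulVec_zero] }
  exact ⟨Submodule.IsPrincipal.generator I, fun g => Submodule.IsPrincipal.mem_iff_generator_dvd I⟩

theorem aeval_mod_mulVec {F : Type*} [Field F] {m : Type*} [Fintype m] [DecidableEq m]
    (A : Matrix m m F) (e : m → F) {q : F[X]} (hq : aeval A q *ᵥ e = 0) (h : F[X]) :
    aeval A (h % q) *ᵥ e = aeval A h *ᵥ e := by
  conv_rhs => rw [← EuclideanDomain.mod_add_div h q, map_add, add_mulVec, mul_comm q,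
    aeval_mul_mulVec, hq, mulVec_zero, add_zero]

theorem exists_eq_add_smul_of_comp_eq {n p : ℕ} {v w : Fin n → ℤ}
    (h : Int.castRingHom (ZMod p) ∘ v = Int.castRingHom (ZMod p) ∘ w) :
    ∃ t : Fin n → ℤ, v = w + (p : ℤ) • t := by
  have h1 : ∀ i, (p : ℤ) ∣ v i - w i := fun i => by
    rw [← castRingHom_eq_zero_iff, map_sub, sub_eq_zero]; exact congrFun h i
  choose t ht using h1
  exact ⟨t, funext fun i => by simp [← ht]⟩

theorem exists_eq_add_C_mul_of_map_eq {p : ℕ} {f g : ℤ[X]}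
    (h : f.map (Int.castRingHom (ZMod p)) = g.map (Int.castRingHom (ZMod p))) :
    ∃ k : ℤ[X], f = g + C (p : ℤ) * k := by
  have h1 : C (p : ℤ) ∣ f - g := by
    rw [C_dvd_iff_dvd_coeff]
    intro i
    rw [← castRingHom_eq_zero_iff, coeff_sub, map_sub, sub_eq_zero, ← coeff_map, ← coeff_map, h]
  obtain ⟨k, hk⟩ := h1
  exact ⟨k, by rw [← hk]; ring⟩

namespace IsIntertwiner

variable {n : ℕ} {A B U : Matrix (Fin n) (Fin n) ℤ} {l : ℤ} {p : ℕ}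

local notation "π" => Int.castRingHom (ZMod p)

theorem dotProduct_aeval_one (h : IsIntertwiner A B U l) (f : ℤ[X]) (z : Fin n → ℤ) :
    (U *ᵥ z) ⬝ᵥ aeval A f *ᵥ 1 = l * (1 ⬝ᵥ aeval B f *ᵥ z) := by
  rw [dotProduct_mulVec_comm (isSymm_aeval h.symm f), dotProduct_comm, h.one_dotProduct_aeval]

theorem dvd_vecMul_walk (h : IsIntertwiner A B U l) (hl : (p : ℤ) ∣ l) (z : Fin n → ℤ)
    (j : Fin n) : (p : ℤ) ∣ ((U *ᵥ z) ᵥ* walk A) j := by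
  have := h.dotProduct_aeval_one (X ^ (j : ℕ)) z
  rw [aeval_X_pow] at this
  rw [vecMul_walk, this]
  exact hl.mul_right _

variable [Fact p.Prime]

/-- If `p²` does not divide `det W`, then the left kernel of `W` modulo `p` is a line, spanned by an
isotropic vector `v`, which then lies in the column space of `W`. -/
theorem exists_aeval_mulVec_one_eq (h : IsIntertwiner A B U l) (hl : (p : ℤ) ∣ l)
    (hW : ¬ (p : ℤ) ^ 2 ∣ (walk A).det) {z : Fin n → ℤ} (hz : π ∘ (U *ᵥ z) ≠ 0) :
    ∃ g : (ZMod p)[X], aeval (A.map π) g *ᵥ 1 = π ∘ (U *ᵥ z) := by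
  set v := π ∘ (U *ᵥ z) with hv
  suffices hmem : v ∈ LinearMap.range ((walk A).map π).mulVecLin by
    obtain ⟨c, hc⟩ := hmem
    exact ⟨ofFn n c, by rw [← walk_mulVec, ← walk_map]; exact hc⟩
  by_contra hmem
  obtain ⟨f, hfv, hf⟩ := Submodule.exists_le_ker_of_notMem hmem
  obtain ⟨u, hu⟩ : ∃ u : Fin n → ZMod p, ∀ x, f x = u ⬝ᵥ x :=
    ⟨fun i => f (Pi.single i 1), fun x => by
      conv_lhs => rw [← Finset.univ_sum_single x]
      rw [map_sum]
      refine Finset.sum_congr rfl fun i _ => ?_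
      rw [show Pi.single i (x i) = x i • Pi.single (M := fun _ => ZMod p) i 1 by
        rw [← Pi.single_smul, smul_eq_mul, mul_one], map_smul, smul_eq_mul, mul_comm]⟩
  rw [hu] at hfv
  have hvv : v ⬝ᵥ v = 0 := by
    have := h.castRingHom_dotProduct_aeval hl 1 z
    rwa [map_one, one_mulVec] at this
  let u' : Fin n → ℤ := Function.surjInv castRingHom_surjective ∘ u
  have hu' : π ∘ u' = u := _root_.funext fun j => Function.surjInv_eq castRingHom_surjective (u j)
  apply hW
  have key := pow_dvd_det π castRingHom_surjective prime_cast castRingHom_eq_zero_iff (walk A)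
    ![u', U *ᵥ z] (by
      have : (fun i => π ∘ (![u', U *ᵥ z] i)) = ![u, v] := by
        funext i
        fin_cases i
        · exact hu'
        · rfl
      rw [this, LinearIndependent.pair_iff]
      intro s t hst
      have h1 := congrArg (fun x => x ⬝ᵥ v) hst
      simp only [add_dotProduct, smul_dotProduct, hvv, mul_zero, add_zero, zero_dotProduct,
        smul_eq_mul] at h1
      have hs : s = 0 := (mul_eq_zero.1 h1).resolve_right hfv
      rw [hs, zero_smul, zero_add] at hst
      exact ⟨hs, (smul_eq_zero.1 hst).resolve_right hz⟩)
    (fun i j => by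
      fin_cases i
      · have h1 : f (((walk A).map π).mulVecLin (Pi.single j 1)) = 0 := hf ⟨_, rfl⟩
        rw [hu, mulVecLin_apply, dotProduct_mulVec, dotProduct_single, mul_one, ← hu',
          ← RingHom.map_vecMul, castRingHom_eq_zero_iff] at h1
        exact h1
      · exact h.dvd_vecMul_walk hl z j)
  simpa using key

theorem sq_dvd_det_walk (h : IsIntertwiner A B U l) (hl : (p : ℤ) ∣ l) (hU : U.map π ≠ 0) :
    (p : ℤ) ^ 2 ∣ (walk A).det := by
  by_contra hW
  apply hW
  obtain ⟨φ, hmon, hφ, z, hz, hφz⟩ := h.exists_irreducible hU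
  -- The vectors `Aⁱ v`, `i < deg φ`, lie in the left kernel of `W`, so `φ` is linear.
  have hdeg : φ.natDegree = 1 := by
    have hpos := hφ.natDegree_pos
    by_contra hne
    apply hW
    have key := pow_dvd_det π castRingHom_surjective prime_cast castRingHom_eq_zero_iff (walk A)
      (fun i : Fin φ.natDegree => A ^ (i : ℕ) *ᵥ (U *ᵥ z))
      (by
        convert linearIndependent_pow_mulVec (A.map π) hφ hz hφz using 2 with i
        have := comp_aeval_mulVec π A (X ^ (i : ℕ)) (U *ᵥ z)
        rwa [Polynomial.map_pow, map_X, aeval_X_pow, aeval_X_pow] at this)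
      (fun i j => by
        have e1 : A ^ (i : ℕ) *ᵥ (U *ᵥ z) = U *ᵥ (aeval B (X ^ (i : ℕ) : ℤ[X]) *ᵥ z) := by
          rw [mulVec_mulVec, mulVec_mulVec, ← h.aeval_mul, aeval_X_pow]
        rw [e1]
        exact h.dvd_vecMul_walk hl _ j)
    rw [Fintype.card_fin] at key
    exact (pow_dvd_pow _ (by omega)).trans key
  obtain ⟨g, hg⟩ := h.exists_aeval_mulVec_one_eq hl hW hz
  obtain ⟨q, hq⟩ := exists_generator_annihilator (A.map π) 1
  have hq1 : aeval (A.map π) q *ᵥ 1 = 0 := (hq q).2 dvd_rfl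
  -- The walk matrix is singular modulo `p`, so `q` is nonzero of degree less than `n`.
  obtain ⟨c, hc0, hc⟩ : ∃ c ≠ 0, (walk A).map π *ᵥ c = 0 := by
    rw [exists_mulVec_eq_zero_iff, ← exists_vecMul_eq_zero_iff]
    refine ⟨_, hz, ?_⟩
    funext j
    rw [← RingHom.map_vecMul]
    exact (castRingHom_eq_zero_iff _).2 (h.dvd_vecMul_walk hl z j)
  have hqc : q ∣ ofFn n c := by
    rw [← hq, ← walk_mulVec, ← walk_map, hc]
  have hc0' : ofFn n c ≠ 0 := fun h0 => hc0 (injective_ofFn n (by rw [h0, map_zero]))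
  have hq0 : q ≠ 0 := fun h0 => hc0' (zero_dvd_iff.1 (h0 ▸ hqc))
  have hqn : q.natDegree < n := by
    have h1 := ofFn_degree_lt c
    rw [degree_eq_natDegree hc0'] at h1
    exact (natDegree_le_of_dvd hqc hc0').trans_lt (by exact_mod_cast h1)
  set r := g % q with hr
  have hrv : aeval (A.map π) r *ᵥ 1 = π ∘ (U *ᵥ z) := by
    rw [hr, aeval_mod_mulVec _ _ hq1, hg]
  have hr0 : r ≠ 0 := fun h0 => hz (by rw [← hrv, h0]; simp)
  have hrq : r.degree < q.degree := EuclideanDomain.mod_lt g hq0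
  obtain ⟨s, hs⟩ : q ∣ φ * r := by
    rw [← hq, aeval_mul_mulVec, hrv, hφz]
  have hs0 : s ≠ 0 := fun h0 => mul_ne_zero hφ.ne_zero hr0 (by rw [hs, h0, mul_zero])
  obtain ⟨b, rfl⟩ : ∃ b, s = C b := by
    refine ⟨_, eq_C_of_natDegree_eq_zero ?_⟩
    have h1 := congrArg natDegree hs
    rw [natDegree_mul hφ.ne_zero hr0, natDegree_mul hq0 hs0, hdeg] at h1
    have h2 := natDegree_lt_natDegree hr0 hrq
    omega
  -- Lift everything to the integers.
  obtain ⟨b, rfl⟩ := castRingHom_surjective b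
  obtain ⟨φ, rfl⟩ := map_surjective π castRingHom_surjective φ
  obtain ⟨r, hr'⟩ := map_surjective π castRingHom_surjective r
  rw [← hr'] at hs hrv
  have hb : ¬ (p : ℤ) ∣ b := fun hb => hs0 (by rw [(castRingHom_eq_zero_iff b).2 hb, C_0])
  let w : Fin n → ℤ := fun i => Function.surjInv castRingHom_surjective (q.coeff i)
  have hw : (ofFn n w).map π = q := by
    ext i
    rw [coeff_map]
    by_cases hi : i < n
    · rw [ofFn_coeff_eq_val_of_lt _ hi]
      exact Function.surjInv_eq castRingHom_surjective _
    · rw [ofFn_coeff_eq_zero_of_ge _ (by omega), map_zero, coeff_eq_zero_of_natDegree_lt (by omega)]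
  obtain ⟨k, hk⟩ : ∃ k : ℤ[X], φ * r = ofFn n w * C b + C (p : ℤ) * k :=
    exists_eq_add_C_mul_of_map_eq (by
      rw [Polynomial.map_mul, hs, Polynomial.map_mul, hw, map_C])
  obtain ⟨t, ht⟩ : ∃ t : Fin n → ℤ, aeval A r *ᵥ 1 = U *ᵥ z + (p : ℤ) • t :=
    exists_eq_add_smul_of_comp_eq (by
      rw [comp_aeval_mulVec, ← hrv]
      congr 1
      funext i; simp)
  have hφdvd : ∀ i, (p : ℤ) ∣ (aeval A φ *ᵥ (U *ᵥ z)) i := fun i => by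
    rw [← castRingHom_eq_zero_iff]
    have := congrFun (comp_aeval_mulVec π A φ (U *ᵥ z)) i
    rw [hφz] at this
    exact this
  have hvw : (p : ℤ) ^ 2 ∣ (U *ᵥ z) ⬝ᵥ walk A *ᵥ w := by
    refine prime_cast.pow_dvd_of_dvd_mul_left _ hb ?_
    have e1 : b * ((U *ᵥ z) ⬝ᵥ walk A *ᵥ w) =
        (U *ᵥ z) ⬝ᵥ aeval A φ *ᵥ (U *ᵥ z) + p * ((aeval A φ *ᵥ (U *ᵥ z)) ⬝ᵥ t)
          - p * ((U *ᵥ z) ⬝ᵥ aeval A k *ᵥ 1) := by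
      have e2 : (U *ᵥ z) ⬝ᵥ aeval A (φ * r) *ᵥ 1 =
          (U *ᵥ z) ⬝ᵥ aeval A (ofFn n w * C b + C (p : ℤ) * k) *ᵥ 1 := by rw [hk]
      rw [aeval_mul_mulVec, ht, mulVec_add, dotProduct_add, mulVec_smul, dotProduct_smul,
        dotProduct_mulVec_comm (isSymm_aeval h.symm φ) _ t, map_add, map_mul, map_mul, aeval_C,
        aeval_C, Algebra.algebraMap_eq_smul_one, Algebra.algebraMap_eq_smul_one, mul_smul_comm,
        mul_one, smul_mul_assoc, one_mul, add_mulVec, smul_mulVec, smul_mulVec, dotProduct_add,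
        dotProduct_smul, dotProduct_smul, ← walk_mulVec] at e2
      simp only [smul_eq_mul] at e2
      linarith
    rw [e1]
    refine dvd_sub (dvd_add ?_ ?_) ?_
    · rw [h.dotProduct_aeval]
      exact (pow_dvd_pow_of_dvd hl 2).mul_right _
    · rw [pow_two]
      exact mul_dvd_mul_left _ (Finset.dvd_sum fun i _ => (hφdvd i).mul_right _)
    · rw [pow_two, h.dotProduct_aeval_one]
      exact mul_dvd_mul_left _ (hl.mul_right _)
  have key := pow_succ_dvd_det π castRingHom_surjective prime_cast castRingHom_eq_zero_iff
    (walk A) (fun _ : Unit => U *ᵥ z) (linearIndependent_unique_iff.2 hz)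
    (fun _ j => h.dvd_vecMul_walk hl z j) w
    (fun h0 => hq0 (by rw [← hw, map_ofFn, h0, map_zero]))
    (fun j => by
      rw [← castRingHom_eq_zero_iff, RingHom.map_mulVec, walk_map, walk_mulVec, ← map_ofFn, hw,
        hq1]
      rfl)
    (fun _ => hvw)
  simpa using key

end IsIntertwiner

/-! ### Parity of the walk matrix -/

theorem coeff_lift {p : ℕ} (φ : (ZMod p)[X]) (i : ℕ) : (lift φ).coeff i = ((φ.coeff i).val : ℤ) := by
  simp only [lift, finsetSum_coeff, coeff_C_mul_X_pow, Finset.sum_ite_eq, Finset.mem_range]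
  split_ifs with h
  · rfl
  · rw [coeff_eq_zero_of_natDegree_lt (by omega), ZMod.val_zero, Nat.cast_zero]

theorem map_lift {p : ℕ} [NeZero p] (φ : (ZMod p)[X]) :
    (lift φ).map (Int.castRingHom (ZMod p)) = φ := by
  ext i
  rw [coeff_map, coeff_lift]
  simp

theorem natDegree_lift_le {p : ℕ} (φ : (ZMod p)[X]) : (lift φ).natDegree ≤ φ.natDegree := by
  rw [natDegree_le_iff_coeff_eq_zero]
  intro i hi
  rw [coeff_lift, coeff_eq_zero_of_natDegree_lt hi, ZMod.val_zero, Nat.cast_zero]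

section Parity

variable {n : ℕ}

theorem dotProduct_mulVec_self_eq_zero (A : Matrix (Fin n) (Fin n) (ZMod 2)) (hA : A.IsSymm)
    (hdiag : ∀ i, A i i = 0) (y : Fin n → ZMod 2) : y ⬝ᵥ A *ᵥ y = 0 := by
  have h1 : y ⬝ᵥ A *ᵥ y = ∑ x : Fin n × Fin n, y x.1 * (A x.1 x.2 * y x.2) := by
    simp only [dotProduct, mulVec, Finset.mul_sum, Fintype.sum_prod_type]
  rw [h1]
  refine Finset.sum_involution (fun x _ => x.swap) ?_ ?_ ?_ ?_
  · rintro ⟨i, j⟩ -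
    simp only [Prod.swap]
    rw [hA.apply i j, show y j * (A i j * y i) = y i * (A i j * y j) by ring]
    exact CharTwo.add_self_eq_zero _
  · rintro ⟨i, j⟩ - hne heq
    simp only [Prod.swap, Prod.mk.injEq] at heq
    rw [heq.1, hdiag] at hne
    simp at hne
  · simp
  · simp

/-- The walk count `eᵀ Aᵏ e` is even for `k ≥ 1`: for odd `k` because `A` is alternating, and for
`k = 2 m` because it is congruent to `eᵀ Aᵐ e`. -/
theorem one_dotProduct_pow_mulVec_one (A : Matrix (Fin n) (Fin n) (ZMod 2)) (hA : A.IsSymm)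
    (hdiag : ∀ i, A i i = 0) (k : ℕ) (hk : k ≠ 0) : 1 ⬝ᵥ A ^ k *ᵥ 1 = 0 := by
  induction k using Nat.strong_induction_on with
  | _ k ih =>
    rcases Nat.even_or_odd' k with ⟨m, rfl | rfl⟩
    · have h1 : 1 ⬝ᵥ A ^ (2 * m) *ᵥ 1 = (A ^ m *ᵥ 1) ⬝ᵥ (A ^ m *ᵥ 1) := by
        rw [two_mul, pow_add, ← mulVec_mulVec, dotProduct_mulVec_comm (hA.pow m)]
      have h2 : (A ^ m *ᵥ 1) ⬝ᵥ (A ^ m *ᵥ 1) = 1 ⬝ᵥ A ^ m *ᵥ 1 := by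
        simp only [dotProduct, Pi.one_apply, one_mul]
        refine Finset.sum_congr rfl fun i _ => ?_
        generalize (A ^ m *ᵥ 1) i = a
        revert a
        decide
      rw [h1, h2]
      exact ih m (by omega) (by omega)
    · have h1 : 1 ⬝ᵥ A ^ (2 * m + 1) *ᵥ 1 = (A ^ m *ᵥ 1) ⬝ᵥ A *ᵥ (A ^ m *ᵥ 1) := by
        rw [two_mul, add_assoc, pow_add, pow_succ', ← mulVec_mulVec, ← mulVec_mulVec,
          dotProduct_mulVec_comm (hA.pow m)]
      rw [h1]
      exact dotProduct_mulVec_self_eq_zero A hA hdiag _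

theorem one_dotProduct_aeval_mulVec_one (A : Matrix (Fin n) (Fin n) (ZMod 2)) (hA : A.IsSymm)
    (hdiag : ∀ i, A i i = 0) (f : (ZMod 2)[X]) :
    1 ⬝ᵥ aeval A f *ᵥ 1 = f.coeff 0 * n := by
  induction f using Polynomial.induction_on' with
  | add f g hf hg => rw [map_add, add_mulVec, dotProduct_add, hf, hg, coeff_add, add_mul]
  | monomial k a =>
    rw [aeval_monomial, Algebra.algebraMap_eq_smul_one, smul_mul_assoc, one_mul, smul_mulVec,
      dotProduct_smul, smul_eq_mul, coeff_monomial]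
    rcases eq_or_ne k 0 with rfl | hk
    · simp [dotProduct]
    · rw [one_dotProduct_pow_mulVec_one A hA hdiag k hk, if_neg hk, mul_zero, zero_mul]

theorem gram_walk_mulVec {A : Matrix (Fin n) (Fin n) ℤ} (hA : A.IsSymm) (c : Fin n → ℤ)
    (k : Fin n) :
    (((walk A)ᵀ * walk A) *ᵥ c) k = 1 ⬝ᵥ A ^ (k : ℕ) *ᵥ (walk A *ᵥ c) := by
  rw [← mulVec_mulVec, mulVec_transpose, vecMul_walk, dotProduct_mulVec_comm (hA.pow _),
    dotProduct_comm]

theorem exists_gram_walk_eq (A : Matrix (Fin n) (Fin n) ℤ) (hA : A.IsSymm)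
    (hdiag : ∀ i, A i i = 0) :
    ∃ K : Matrix (Fin n) (Fin n) ℤ,
      (walk A)ᵀ * walk A = diagonal (fun i : Fin n => if Odd n ∧ (i : ℕ) = 0 then 1 else 2) * K := by
  have hmod : ∀ i j : Fin n, ¬ (Odd n ∧ (i : ℕ) = 0) → 2 ∣ ((walk A)ᵀ * walk A) i j := by
    intro i j hi
    have h1 : ((walk A)ᵀ * walk A) i j = 1 ⬝ᵥ aeval A (X ^ ((i : ℕ) + j) : ℤ[X]) *ᵥ 1 := by
      rw [aeval_X_pow, pow_add, ← mulVec_mulVec, dotProduct_mulVec_comm (hA.pow _)]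
      rfl
    rw [h1]
    have h2 := (castRingHom_eq_zero_iff (p := 2) (1 ⬝ᵥ aeval A (X ^ ((i : ℕ) + j) : ℤ[X]) *ᵥ 1)).1
    refine h2 ?_
    have h3 : Int.castRingHom (ZMod 2) ∘ (1 : Fin n → ℤ) = 1 := by funext i; simp
    rw [RingHom.map_dotProduct, comp_aeval_mulVec, h3,
      one_dotProduct_aeval_mulVec_one _ (hA.map _) (fun i => by simp [hdiag])]
    rw [Polynomial.map_pow, map_X, coeff_X_pow]
    by_cases h0 : 0 = (i : ℕ) + j
    · have hn : Even n := by
        rw [← Nat.not_odd_iff_even]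
        exact fun hn => hi ⟨hn, by omega⟩
      rw [if_pos h0, one_mul]
      exact (ZMod.natCast_eq_zero_iff_even).2 hn
    · rw [if_neg h0, zero_mul]
  refine ⟨Matrix.of fun i j => if Odd n ∧ (i : ℕ) = 0 then ((walk A)ᵀ * walk A) i j
    else ((walk A)ᵀ * walk A) i j / 2, ?_⟩
  ext i j
  rw [diagonal_mul, of_apply]
  split_ifs with h
  · rw [one_mul]
  · exact (Int.mul_ediv_cancel' (hmod i j h)).symm

theorem prod_ite_odd (n : ℕ) :
    ∏ i : Fin n, (if Odd n ∧ (i : ℕ) = 0 then (1 : ℤ) else 2) = (2 ^ (n / 2)) ^ 2 := by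
  rcases Nat.even_or_odd' n with ⟨m, rfl | rfl⟩
  · have h : ¬ Odd (2 * m) := by simp
    simp only [h, false_and, if_false, Finset.prod_const, Finset.card_univ, Fintype.card_fin]
    rw [← pow_mul]
    congr 1
    omega
  · have h : Odd (2 * m + 1) := by simp
    rw [Fin.prod_univ_succ]
    simp only [h, true_and, Fin.val_zero, if_true, Fin.val_succ, Nat.succ_ne_zero, if_false,
      Finset.prod_const, Finset.card_univ, Fintype.card_fin, one_mul,
      and_false]
    rw [← pow_mul]
    congr 1
    omega

theorem two_pow_dvd_det_walk (A : Matrix (Fin n) (Fin n) ℤ) (hA : A.IsSymm)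
    (hdiag : ∀ i, A i i = 0) : 2 ^ (n / 2) ∣ (walk A).det := by
  obtain ⟨K, hK⟩ := exists_gram_walk_eq A hA hdiag
  have h := congrArg det hK
  rw [det_mul, det_mul, det_transpose, det_diagonal, prod_ite_odd, ← pow_two] at h
  exact (Int.pow_dvd_pow_iff two_ne_zero).1 ⟨_, h⟩

/-- Modulo `2` the span of the `Aᵏ e` (of those with `k ≥ 1`, if `n` is odd) is isotropic, hence of
dimension at most `n / 2`. -/
theorem exists_annihilator_natDegree_le (A : Matrix (Fin n) (Fin n) (ZMod 2)) (hA : A.IsSymm)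
    (hdiag : ∀ i, A i i = 0) :
    ∃ f : (ZMod 2)[X], f ≠ 0 ∧ f.natDegree ≤ (n + 1) / 2 ∧ aeval A f *ᵥ 1 = 0 := by
  let N : Matrix (Fin n) (Fin (n / 2 + 1)) (ZMod 2) :=
    Matrix.of fun i j => (A ^ ((j : ℕ) + n % 2) *ᵥ 1) i
  have hN : Nᵀ * N = 0 := by
    ext i j
    have h1 : (Nᵀ * N) i j = 1 ⬝ᵥ A ^ ((i : ℕ) + n % 2 + (j + n % 2)) *ᵥ 1 := by
      rw [pow_add _ ((i : ℕ) + n % 2), ← mulVec_mulVec, dotProduct_mulVec_comm (hA.pow _)]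
      rfl
    rw [h1, Matrix.zero_apply]
    by_cases h0 : (i : ℕ) + n % 2 + (j + n % 2) = 0
    · rw [h0, pow_zero, one_mulVec]
      have : Even n := Nat.even_iff.2 (by omega)
      simpa [dotProduct] using (ZMod.natCast_eq_zero_iff_even).2 this
    · exact one_dotProduct_pow_mulVec_one A hA hdiag _ h0
  have hrank := rank_add_rank_le_card_of_mul_eq_zero hN
  rw [rank_transpose, Fintype.card_fin] at hrank
  obtain ⟨c, hc, hc0⟩ : ∃ c, N.mulVecLin c = 0 ∧ c ≠ 0 := by
    have hker : LinearMap.ker N.mulVecLin ≠ ⊥ := by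
      intro h0
      have := LinearMap.finrank_range_add_finrank_ker N.mulVecLin
      rw [h0, finrank_bot, Module.finrank_fin_fun] at this
      have h2 : N.rank = Module.finrank (ZMod 2) (LinearMap.range N.mulVecLin) := rfl
      omega
    obtain ⟨c, hc, hc0⟩ := (Submodule.ne_bot_iff _).1 hker
    exact ⟨c, hc, hc0⟩
  have hne : ofFn (n / 2 + 1) c ≠ 0 := fun h0 => hc0 (injective_ofFn _ (by rw [h0, map_zero]))
  refine ⟨ofFn (n / 2 + 1) c * X ^ (n % 2), mul_ne_zero hne (pow_ne_zero _ X_ne_zero), ?_, ?_⟩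
  · rw [natDegree_mul hne (pow_ne_zero _ X_ne_zero), natDegree_X_pow]
    have := ofFn_natDegree_lt (Nat.le_add_left 1 (n / 2)) c
    omega
  · rw [aeval_mul_mulVec, aeval_ofFn_mulVec, ← hc]
    funext i
    simp only [Finset.sum_apply, Pi.smul_apply, smul_eq_mul, mulVec_mulVec, aeval_X_pow,
      ← pow_add, mulVecLin_apply]
    exact Finset.sum_congr rfl fun j _ => mul_comm _ _

end Parity

/-! ### The prime two -/

namespace IsIntertwiner

variable {n : ℕ} {A B U : Matrix (Fin n) (Fin n) ℤ} {l : ℤ}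

local notation "π" => Int.castRingHom (ZMod 2)

/-- If the reduced Gram matrix `K` of the walk matrix is invertible modulo `2`, every vector in
the column span of `U` is a polynomial in `A` applied to `e`, modulo `2`. -/
theorem exists_aeval_mulVec_one_eq_of_odd (h : IsIntertwiner A B U l) (hl : 2 ∣ l)
    (hW : (walk A).det ≠ 0) {K : Matrix (Fin n) (Fin n) ℤ}
    (hK : (walk A)ᵀ * walk A = diagonal (fun i : Fin n => if Odd n ∧ (i : ℕ) = 0 then 1 else 2) * K)
    (hKdet : ¬ 2 ∣ K.det) (z : Fin n → ℤ) :
    ∃ g : (ZMod 2)[X], aeval (A.map π) g *ᵥ 1 = π ∘ (U *ᵥ z) := by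
  have hv : ∀ j, 2 ∣ ((U *ᵥ z) ᵥ* walk A) j := fun j => h.dvd_vecMul_walk (p := 2) hl z j
  choose a ha using hv
  let D' : Fin n → ℤ := fun i => if Odd n ∧ (i : ℕ) = 0 then 2 else 1
  let c : Fin n → ℤ := K.adjugate *ᵥ (diagonal D' *ᵥ a)
  have hc : walk A *ᵥ c = K.det • (U *ᵥ z) := by
    rw [← sub_eq_zero]
    refine eq_zero_of_mulVec_eq_zero (M := (walk A)ᵀ) (by rwa [det_transpose]) ?_
    rw [mulVec_sub, mulVec_mulVec, hK, mulVec_smul, mulVec_transpose, sub_eq_zero]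
    simp only [c]
    rw [mulVec_mulVec, Matrix.mul_assoc, mul_adjugate, mulVec_mulVec, Matrix.mul_smul, mul_one,
      smul_mul_assoc, diagonal_mul_diagonal, smul_mulVec]
    congr 1
    funext i
    rw [mulVec_diagonal, ha]
    simp only [D']
    split_ifs <;> ring
  have hdet : π K.det = 1 := by
    have h1 : π K.det ≠ 0 := fun h0 => hKdet ((castRingHom_eq_zero_iff (p := 2) _).1 h0)
    revert h1
    generalize π K.det = x
    revert x
    decide
  refine ⟨ofFn n (π ∘ c), ?_⟩
  rw [← walk_mulVec, ← walk_map]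
  funext i
  rw [← RingHom.map_mulVec, hc, Pi.smul_apply, smul_eq_mul, map_mul, hdet, one_mul,
    Function.comp_apply]

/-- If `h(A) e + 2 β` lies in the column span of `U`, then `eᵀ Aᵏ h(A)² e` is divisible by `4`. Replacing
`h(x)²` by `h(x²)` changes this by twice an even number, so the coefficient vector of `h(x²)` is
annihilated by the Gram matrix `Wᵀ W` modulo `4`. -/
theorem two_pow_succ_dvd_det_walk (h : IsIntertwiner A B U l) (hdiag : ∀ i, A i i = 0)
    (hl : 2 ∣ l) (hU : U.map π ≠ 0) : 2 ^ (n / 2 + 1) ∣ (walk A).det := by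
  have hA : (A.map π).IsSymm := h.symm.map _
  have hdiag' : ∀ i, A.map π i i = 0 := fun i => by simp [hdiag]
  have h1 : π ∘ (1 : Fin n → ℤ) = 1 := by funext i; simp
  obtain ⟨K, hK⟩ := exists_gram_walk_eq A h.symm hdiag
  suffices hKdet : 2 ∣ K.det by
    obtain ⟨m, hm⟩ := two_pow_dvd_det_walk A h.symm hdiag
    have hdet := congrArg det hK
    rw [det_mul, det_mul, det_transpose, det_diagonal, prod_ite_odd, hm] at hdet
    have h2 : m * m = K.det := by
      have h3 : ((2 : ℤ) ^ (n / 2)) ^ 2 ≠ 0 := by positivity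
      apply mul_left_cancel₀ h3
      rw [← hdet]
      ring
    rw [← h2] at hKdet
    rw [hm, pow_succ]
    exact mul_dvd_mul_left _ ((Int.prime_two.dvd_mul.1 hKdet).elim id id)
  by_contra hKdet
  have hW : (walk A).det ≠ 0 := by
    intro h0
    have hdet := congrArg det hK
    rw [det_mul, det_mul, det_transpose, det_diagonal, prod_ite_odd, h0, mul_zero] at hdet
    have h3 : ((2 : ℤ) ^ (n / 2)) ^ 2 ≠ 0 := by positivity
    rw [(mul_eq_zero.1 hdet.symm).resolve_left h3] at hKdet
    exact hKdet (dvd_zero _)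
  obtain ⟨-, -, -, z, hz, -⟩ := h.exists_irreducible (p := 2) hU
  obtain ⟨g, hg⟩ := h.exists_aeval_mulVec_one_eq_of_odd hl hW hK hKdet z
  obtain ⟨q, hq0, hqdeg, hq⟩ := exists_annihilator_natDegree_le (A.map π) hA hdiag'
  set r := g % q with hr
  have hrv : aeval (A.map π) r *ᵥ 1 = π ∘ (U *ᵥ z) := by
    rw [hr, aeval_mod_mulVec _ _ hq, hg]
  have hr0 : r ≠ 0 := fun h0 => hz (by rw [← hrv, h0]; simp)
  have hrdeg : r.natDegree < (n + 1) / 2 :=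
    (natDegree_lt_natDegree hr0 (EuclideanDomain.mod_lt g hq0)).trans_le hqdeg
  have hrcoeff : Odd n → r.coeff 0 = 0 := by
    intro hn
    have h2 := one_dotProduct_aeval_mulVec_one (A.map π) hA hdiag' r
    have h3 := h.one_dotProduct_castRingHom_aeval (p := 2) hl 1 z
    rw [map_one, one_mulVec] at h3
    rw [hrv, h3, (ZMod.natCast_eq_one_iff_odd).2 hn, mul_one] at h2
    exact h2.symm
  obtain ⟨t, ht⟩ : ∃ t : ℤ[X], lift r ^ 2 = expand ℤ 2 (lift r) + C ((2 : ℕ) : ℤ) * t :=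
    exists_eq_add_C_mul_of_map_eq (p := 2) (by
      rw [Polynomial.map_pow, map_expand, map_lift, ZMod.expand_card])
  have htn : (Int.castRingHom (ZMod 2) (t.coeff 0)) * n = 0 := by
    rcases Nat.even_or_odd n with hn | hn
    · rw [(ZMod.natCast_eq_zero_iff_even).2 hn, mul_zero]
    · have h2 := congrArg (fun f => coeff f 0) ht
      simp only [coeff_add, pow_two, mul_coeff_zero, coeff_C_zero, coeff_lift, hrcoeff hn] at h2
      rw [coeff_expand two_pos] at h2
      simp only [dvd_zero, if_true, Nat.zero_div, coeff_lift, hrcoeff hn, ZMod.val_zero,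
        Nat.cast_zero, mul_zero, zero_add] at h2
      have h3 : t.coeff 0 = 0 := by
        push_cast at h2
        omega
      rw [h3, map_zero, zero_mul]
  obtain ⟨b, hb⟩ : ∃ b : Fin n → ℤ, aeval A (lift r) *ᵥ 1 = U *ᵥ z + ((2 : ℕ) : ℤ) • b :=
    exists_eq_add_smul_of_comp_eq (p := 2) (by rw [comp_aeval_mulVec, map_lift, ← hrv, h1])
  have hfour : ∀ k : ℕ, 4 ∣ 1 ⬝ᵥ A ^ k *ᵥ (aeval A (expand ℤ 2 (lift r)) *ᵥ 1) := by
    intro k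
    have h2 : expand ℤ 2 (lift r) = lift r ^ 2 - C 2 * t := by rw [ht]; simp
    have h3 : 1 ⬝ᵥ A ^ k *ᵥ (aeval A (lift r ^ 2) *ᵥ 1) =
        (aeval A (lift r) *ᵥ 1) ⬝ᵥ A ^ k *ᵥ (aeval A (lift r) *ᵥ 1) := by
      rw [← dotProduct_mulVec_comm (isSymm_aeval h.symm _), pow_two, aeval_mul_mulVec,
        mulVec_mulVec, mulVec_mulVec, mulVec_mulVec, mulVec_mulVec]
      have hcomm : A ^ k * aeval A (lift r) = aeval A (lift r) * A ^ k := by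
        have := (Commute.all (X ^ k) (lift r)).map (aeval A : ℤ[X] →ₐ[ℤ] Matrix (Fin n) (Fin n) ℤ)
        simpa using this.eq
      rw [hcomm]
    have h4 : 2 ∣ 1 ⬝ᵥ A ^ k *ᵥ (aeval A t *ᵥ 1) := by
      have h5 := (castRingHom_eq_zero_iff (p := 2) (1 ⬝ᵥ aeval A (X ^ k * t) *ᵥ 1)).1 (by
        rw [RingHom.map_dotProduct, comp_aeval_mulVec, h1,
          one_dotProduct_aeval_mulVec_one _ hA hdiag', coeff_map, mul_coeff_zero, map_mul,
          mul_assoc, htn, mul_zero])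
      rwa [aeval_mul_mulVec, aeval_X_pow] at h5
    have h6 : 4 ∣ (U *ᵥ z) ⬝ᵥ A ^ k *ᵥ (U *ᵥ z) := by
      have := h.dotProduct_aeval (X ^ k) z z
      rw [aeval_X_pow] at this
      rw [this]
      exact (pow_dvd_pow_of_dvd hl 2).mul_right _
    have h7 : 1 ⬝ᵥ A ^ k *ᵥ (aeval A (expand ℤ 2 (lift r)) *ᵥ 1) =
        (U *ᵥ z) ⬝ᵥ A ^ k *ᵥ (U *ᵥ z) + 4 * (b ⬝ᵥ A ^ k *ᵥ (U *ᵥ z)) +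
          4 * (b ⬝ᵥ A ^ k *ᵥ b) - 2 * (1 ⬝ᵥ A ^ k *ᵥ (aeval A t *ᵥ 1)) := by
      have h8 : (U *ᵥ z) ⬝ᵥ A ^ k *ᵥ b = b ⬝ᵥ A ^ k *ᵥ (U *ᵥ z) := by
        rw [dotProduct_mulVec_comm (h.symm.pow k), dotProduct_comm]
      rw [h2, map_sub, sub_mulVec, mulVec_sub, dotProduct_sub, h3, hb, map_mul, aeval_C,
        Algebra.algebraMap_eq_smul_one, smul_mul_assoc, one_mul, smul_mulVec, mulVec_smul,
        dotProduct_smul]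
      simp only [mulVec_add, mulVec_smul, dotProduct_add, add_dotProduct, dotProduct_smul,
        smul_dotProduct, smul_eq_mul, h8]
      push_cast
      ring
    rw [h7]
    exact dvd_sub (dvd_add (dvd_add h6 (dvd_mul_right _ _)) (dvd_mul_right _ _))
      (mul_dvd_mul_left 2 h4)
  let c : Fin n → ℤ := fun i => (expand ℤ 2 (lift r)).coeff i
  have hcdeg : (expand ℤ 2 (lift r)).natDegree < n := by
    rw [natDegree_expand]
    have := natDegree_lift_le r
    omega
  have hc : ofFn n c = expand ℤ 2 (lift r) := ofFn_comp_toFn_eq_id_of_natDegree_lt hcdeg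
  have hc0 : π ∘ c ≠ 0 := by
    intro h0
    have h2 : (ofFn n c).map π = 0 := by rw [map_ofFn, h0, map_zero]
    rw [hc, map_expand, map_lift, expand_eq_zero two_pos] at h2
    exact hr0 h2
  apply hKdet
  refine (castRingHom_eq_zero_iff (p := 2) _).1 ?_
  rw [RingHom.map_det]
  refine exists_mulVec_eq_zero_iff.1 ⟨π ∘ c, hc0, ?_⟩
  funext k
  have h2 := gram_walk_mulVec h.symm c k
  have h3 := hfour k
  rw [walk_mulVec, hc] at h2
  rw [← h2, hK, ← mulVec_mulVec, mulVec_diagonal] at h3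
  rw [RingHom.mapMatrix_apply, ← RingHom.map_mulVec]
  refine (castRingHom_eq_zero_iff (p := 2) _).2 ?_
  split_ifs at h3 <;> push_cast <;> omega

end IsIntertwiner

/-! ### From generalized cospectrality to an integral intertwiner -/

section WalkCounts

variable {n : ℕ}

open PowerSeries in
/-- The generating function of the walk counts, `eᵀ (1 - tA)⁻¹ e`, is determined by
`det (1 - tA)` and `det (1 - t(A - J))` through the matrix determinant lemma. -/
theorem exists_powerSeries_walkCount (A : Matrix (Fin n) (Fin n) ℤ) :
    ∃ f : ℤ⟦X⟧, (∀ k, PowerSeries.coeff k f = 1 ⬝ᵥ A ^ k *ᵥ 1) ∧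
      ((A - allOne n).charpolyRev : ℤ⟦X⟧) = (A.charpolyRev : ℤ⟦X⟧) * (1 + PowerSeries.X * f) := by
  have hrev : ∀ M : Matrix (Fin n) (Fin n) ℤ, (M.charpolyRev : ℤ⟦X⟧) =
      det (1 - (PowerSeries.X : ℤ⟦X⟧) • M.map PowerSeries.C) := by
    intro M
    rw [charpolyRev, ← Polynomial.coeToPowerSeries.ringHom_apply, RingHom.map_det]
    congr 1
    ext1 i j
    simp only [RingHom.mapMatrix_apply, Matrix.map_apply, Matrix.sub_apply, Matrix.smul_apply,
      smul_eq_mul, Polynomial.coeToPowerSeries.ringHom_apply, Polynomial.coe_sub,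
      Polynomial.coe_mul, Polynomial.coe_X, Polynomial.coe_C, Matrix.one_apply]
    split_ifs <;> simp
  let P : Matrix (Fin n) (Fin n) ℤ⟦X⟧ := 1 - (PowerSeries.X : ℤ⟦X⟧) • A.map PowerSeries.C
  have hP : IsUnit P.det := by
    rw [← hrev, PowerSeries.isUnit_iff_constantCoeff, ← PowerSeries.coeff_zero_eq_constantCoeff_apply,
      Polynomial.coeff_coe, Polynomial.coeff_zero_eq_eval_zero, eval_charpolyRev]
    exact isUnit_one
  let x : Fin n → ℤ⟦X⟧ := P⁻¹ *ᵥ 1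
  have hx : ∀ i, x i = 1 + PowerSeries.X * ∑ j, PowerSeries.C (A i j) * x j := by
    intro i
    have h1 : P *ᵥ x = 1 := by
      simp only [x]
      rw [mulVec_mulVec, mul_nonsing_inv _ hP, one_mulVec]
    have h2 := congrFun h1 i
    simp only [P, sub_mulVec, one_mulVec, smul_mulVec, Pi.sub_apply, Pi.smul_apply, Pi.one_apply,
      smul_eq_mul] at h2
    rw [← h2]
    simp [mulVec, dotProduct]
  have hcoeff : ∀ k i, PowerSeries.coeff k (x i) = (A ^ k *ᵥ 1) i := by
    intro k
    induction k with
    | zero =>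
      intro i
      rw [hx]
      simp
    | succ k ih =>
      intro i
      rw [hx, map_add, PowerSeries.coeff_succ_X_mul, map_sum, pow_succ', ← mulVec_mulVec,
        PowerSeries.coeff_one, if_neg (Nat.succ_ne_zero k), zero_add]
      simp only [PowerSeries.coeff_C_mul, ih]
      rfl
  refine ⟨∑ i, x i, fun k => ?_, ?_⟩
  · rw [map_sum]
    simp [dotProduct, hcoeff]
  · have h1 : 1 - (PowerSeries.X : ℤ⟦X⟧) • (A - allOne n).map PowerSeries.C =
        P + (replicateCol Unit (fun _ => PowerSeries.X) : Matrix (Fin n) Unit ℤ⟦X⟧) *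
          (replicateRow Unit 1 : Matrix Unit (Fin n) ℤ⟦X⟧) := by
      ext1 i j
      simp [P, allOne, mul_sub, mul_apply]
      ring
    rw [hrev, h1, det_add_replicateCol_mul_replicateRow hP, hrev]
    congr 1
    have h2 : (fun _ => PowerSeries.X : Fin n → ℤ⟦X⟧) = (PowerSeries.X : ℤ⟦X⟧) • 1 := by
      funext i; simp
    rw [det_unique, Matrix.add_apply, Matrix.one_apply_eq, Matrix.mul_assoc,
      ← replicateCol_mulVec, h2, mulVec_smul]
    simp [mul_apply, x, Finset.mul_sum]

theorem walkCount_eq {A B : Matrix (Fin n) (Fin n) ℤ} (h1 : A.charpoly = B.charpoly)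
    (h2 : (A - allOne n).charpoly = (B - allOne n).charpoly) (k : ℕ) :
    1 ⬝ᵥ A ^ k *ᵥ 1 = 1 ⬝ᵥ B ^ k *ᵥ 1 := by
  obtain ⟨f, hf, hfA⟩ := exists_powerSeries_walkCount A
  obtain ⟨g, hg, hgB⟩ := exists_powerSeries_walkCount B
  rw [← reverse_charpoly, ← reverse_charpoly] at hfA hgB
  rw [h2, h1, hgB] at hfA
  have h0 : ((B.charpoly.reverse : ℤ[X]) : PowerSeries ℤ) ≠ 0 := by
    rw [Ne, Polynomial.coe_eq_zero_iff, reverse_eq_zero]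
    exact B.charpoly_monic.ne_zero
  have h3 := mul_left_cancel₀ h0 hfA
  have h4 := mul_left_cancel₀ PowerSeries.X_ne_zero (add_left_cancel h3)
  rw [← hf, ← hg, h4]

theorem charpoly_neg_sub_one (M : Matrix (Fin n) (Fin n) ℤ) :
    (-M - 1).charpoly = (-1) ^ n * M.charpoly.comp (-X - 1) := by
  rw [charpoly, charpoly, ← coe_compRingHom_apply, RingHom.map_det]
  have h1 : charmatrix (-M - 1) =
      -((compRingHom (-X - 1 : ℤ[X])).mapMatrix (charmatrix M)) := by
    ext1 i j
    rcases eq_or_ne i j with rfl | hij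
    · simp [charmatrix_apply_eq]
      ring
    · simp [charmatrix_apply_ne _ _ _ hij, Matrix.one_apply_ne hij]
  rw [h1, det_neg, Fintype.card_fin]

end WalkCounts

section Existence

variable {n : ℕ}

theorem gram_walk_apply {A : Matrix (Fin n) (Fin n) ℤ} (hA : A.IsSymm) (M : Matrix (Fin n) (Fin n) ℤ)
    (i j : Fin n) :
    ((walk A)ᵀ * (M * walk A)) i j = 1 ⬝ᵥ (A ^ (i : ℕ) * (M * A ^ (j : ℕ))) *ᵥ 1 := by
  rw [← mulVec_mulVec, dotProduct_mulVec_comm (hA.pow _), ← mulVec_mulVec]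
  rfl

theorem exists_isIntertwiner {A B : Matrix (Fin n) (Fin n) ℤ} (hA : A.IsSymm) (hB : B.IsSymm)
    (hw : ∀ k : ℕ, 1 ⬝ᵥ A ^ k *ᵥ 1 = 1 ⬝ᵥ B ^ k *ᵥ 1) (hdet : (walk A).det ≠ 0) :
    ∃ (l : ℕ) (U : Matrix (Fin n) (Fin n) ℤ), 0 < l ∧ IsIntertwiner A B U l := by
  have hgram : (walk A)ᵀ * walk A = (walk B)ᵀ * walk B := by
    ext i j
    have h1 := gram_walk_apply hA 1 i j
    have h2 := gram_walk_apply hB 1 i j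
    rw [one_mul, one_mul, ← pow_add] at h1 h2
    rw [h1, h2, hw]
  have hgram' : (walk A)ᵀ * (A * walk A) = (walk B)ᵀ * (B * walk B) := by
    ext i j
    rw [gram_walk_apply hA, gram_walk_apply hB, ← pow_succ', ← pow_succ', ← pow_add, ← pow_add, hw]
  set d := (walk B).det with hd
  have hdB : d ≠ 0 := by
    have := congrArg det hgram
    rw [det_mul, det_mul, det_transpose, det_transpose, ← hd] at this
    intro h0
    rw [h0, mul_zero] at this
    exact mul_self_ne_zero.2 hdet this
  have hcancel : ∀ M N : Matrix (Fin n) (Fin n) ℤ, (walk A)ᵀ * M = (walk A)ᵀ * N → M = N := by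
    intro M N h
    have h1 := congrArg (fun Z => (walk A)ᵀ.adjugate * Z) h
    simp only [← Matrix.mul_assoc, adjugate_mul, smul_mul_assoc, one_mul, det_transpose] at h1
    exact smul_right_injective _ hdet h1
  let V := walk A * (walk B).adjugate
  have hWV : (walk A)ᵀ * V = d • (walk B)ᵀ := by
    simp only [V]
    rw [← Matrix.mul_assoc, hgram, Matrix.mul_assoc, mul_adjugate, Matrix.mul_smul, mul_one]
  have hVcomm : A * V = V * B := by
    apply hcancel
    rw [← Matrix.mul_assoc _ V, hWV]
    simp only [V]
    rw [← Matrix.mul_assoc A, ← Matrix.mul_assoc, hgram', Matrix.mul_assoc, Matrix.mul_assoc,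
      mul_adjugate, Matrix.mul_smul, mul_one, Matrix.mul_smul, smul_mul_assoc]
  have hVgram : Vᵀ * V = d ^ 2 • (1 : Matrix (Fin n) (Fin n) ℤ) := by
    simp only [V]
    rw [transpose_mul, Matrix.mul_assoc, ← Matrix.mul_assoc (walk A)ᵀ, hgram,
      Matrix.mul_assoc (walk B)ᵀ, mul_adjugate, Matrix.mul_smul, mul_one, Matrix.mul_smul,
      ← transpose_mul, mul_adjugate, transpose_smul, transpose_one, smul_smul, pow_two]
  have hV1 : V *ᵥ 1 = d • 1 := by
    rcases n with _ | n
    · exact Subsingleton.elim _ _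
    have h0 : ∀ M : Matrix (Fin (n + 1)) (Fin (n + 1)) ℤ, walk M *ᵥ Pi.single 0 1 = 1 := by
      intro M
      funext i
      simp [walk]
    simp only [V]
    rw [← h0 B, mulVec_mulVec, Matrix.mul_assoc, adjugate_mul, Matrix.mul_smul, mul_one,
      smul_mulVec, h0 A, h0 B]
  have hV1' : Vᵀ *ᵥ 1 = d • 1 := by
    have h1 : d • (Vᵀ *ᵥ 1) = d • (d • (1 : Fin n → ℤ)) := by
      rw [smul_smul, ← pow_two, ← mulVec_smul, ← hV1, mulVec_mulVec, hVgram, smul_mulVec, one_mulVec]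
    exact smul_right_injective _ hdB h1
  have hs : d.sign * d.sign = 1 := by
    rcases Int.sign_trichotomy d with h | h | h
    · simp [h]
    · exact absurd (Int.sign_eq_zero_iff_zero.1 h) hdB
    · simp [h]
  have habs : (d.natAbs : ℤ) = d.sign * d := (Int.sign_mul_self_eq_natAbs d).symm
  refine ⟨d.natAbs, d.sign • V, Int.natAbs_pos.2 hdB, hA, ?_, ?_, ?_, ?_⟩
  · rw [Matrix.mul_smul, smul_mul_assoc, hVcomm]
  · rw [transpose_smul, smul_mul_assoc, Matrix.mul_smul, smul_smul, hVgram, hs, one_smul,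
      Int.natAbs_sq]
  · rw [smul_mulVec, hV1, smul_smul, habs]
  · rw [transpose_smul, smul_mulVec, hV1', smul_smul, habs]

/-- Taking the level `l` minimal, `U` is nonzero modulo each prime divisor of `l`. -/
theorem exists_primitive_isIntertwiner {A B : Matrix (Fin n) (Fin n) ℤ} (hA : A.IsSymm)
    (hB : B.IsSymm) (hw : ∀ k : ℕ, 1 ⬝ᵥ A ^ k *ᵥ 1 = 1 ⬝ᵥ B ^ k *ᵥ 1)
    (hdet : (walk A).det ≠ 0) :
    ∃ (l : ℕ) (U : Matrix (Fin n) (Fin n) ℤ), 0 < l ∧ IsIntertwiner A B U l ∧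
      ∀ p : ℕ, p.Prime → p ∣ l → U.map (Int.castRingHom (ZMod p)) ≠ 0 := by
  classical
  have hex := exists_isIntertwiner hA hB hw hdet
  obtain ⟨U, hl, hU⟩ := Nat.find_spec hex
  refine ⟨Nat.find hex, U, hl, hU, ?_⟩
  rintro p hp ⟨l', hl'⟩ h0
  have hp0 : (p : ℤ) ≠ 0 := by exact_mod_cast hp.ne_zero
  have hdvd : ∀ i j, (p : ℤ) ∣ U i j := fun i j =>
    (castRingHom_eq_zero_iff _).1 (congrFun (congrFun h0 i) j)
  obtain ⟨V, rfl⟩ : ∃ V : Matrix (Fin n) (Fin n) ℤ, U = (p : ℤ) • V := by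
    choose V hV using hdvd
    exact ⟨Matrix.of V, by ext i j; exact hV i j⟩
  have hlt : l' < Nat.find hex := by
    rw [hl'] at hl ⊢
    have : 0 < l' := Nat.pos_of_mul_pos_left hl
    nlinarith [hp.two_le]
  refine Nat.find_min hex hlt ⟨V, by rw [hl'] at hl; exact Nat.pos_of_mul_pos_left hl, ?_⟩
  rw [hl'] at hU
  push_cast at hU
  refine ⟨hA, ?_, ?_, ?_, ?_⟩
  · have := hU.comm
    rw [Matrix.mul_smul, smul_mul_assoc] at this
    exact smul_right_injective _ hp0 this
  · have := hU.gram
    rw [transpose_smul, smul_mul_assoc, Matrix.mul_smul, smul_smul, mul_pow, ← pow_two,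
      mul_smul] at this
    exact smul_right_injective _ (pow_ne_zero 2 hp0) this
  · have := hU.mulVec_one
    rw [smul_mulVec, mul_smul] at this
    exact smul_right_injective _ hp0 this
  · have := hU.transpose_mulVec_one
    rw [transpose_smul, smul_mulVec, mul_smul] at this
    exact smul_right_injective _ hp0 this

/-- An intertwiner of level one is a permutation matrix. -/
theorem IsIntertwiner.exists_perm {A B U : Matrix (Fin n) (Fin n) ℤ} (h : IsIntertwiner A B U 1) :
    ∃ σ : Equiv.Perm (Fin n), ∀ i j, A (σ i) (σ j) = B i j := by
  have hgram : ∀ i j, ∑ k, U k i * U k j = if i = j then 1 else 0 := by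
    intro i j
    have := congrFun (congrFun h.gram i) j
    simpa [mul_apply, Matrix.one_apply] using this
  have hsum : ∀ j, ∑ k, U k j = 1 := by
    intro j
    have := congrFun h.transpose_mulVec_one j
    simpa [mulVec, dotProduct] using this
  -- The entries of a column and their squares have the same sum, so all entries are `0` or `1`.
  have h01 : ∀ k j, U k j * U k j = U k j := by
    intro k j
    have h1 : ∑ k, (U k j * U k j - U k j) = 0 := by
      rw [Finset.sum_sub_distrib, hgram, hsum, if_pos rfl, sub_self]
    have h2 : ∀ k ∈ Finset.univ, 0 ≤ U k j * U k j - U k j := by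
      intro k _
      rcases le_or_gt (U k j) 0 with hk | hk
      · nlinarith
      · nlinarith
    exact sub_eq_zero.1 ((Finset.sum_eq_zero_iff_of_nonneg h2).1 h1 k (Finset.mem_univ k))
  have hex : ∀ j, ∃ k, U k j = 1 := by
    intro j
    by_contra! hne
    have h0 : ∀ k, U k j = 0 := fun k => by
      have h1 : U k j * (U k j - 1) = 0 := by linarith [h01 k j]
      exact (mul_eq_zero.1 h1).resolve_right (sub_ne_zero.2 (hne k))
    have := hsum j
    simp [h0] at this
  choose σ hσ using hex
  have huniq : ∀ k j, k ≠ σ j → U k j = 0 := by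
    intro k j hk
    have h1 := hgram j j
    simp only [h01, if_true] at h1
    rw [← Finset.add_sum_erase _ _ (Finset.mem_univ (σ j)), hσ, add_eq_left] at h1
    refine (Finset.sum_eq_zero_iff_of_nonneg fun i _ => ?_).1 h1 k (by simp [hk])
    rw [← h01]
    exact mul_self_nonneg _
  have hU : ∀ k j, U k j = if k = σ j then 1 else 0 := by
    intro k j
    split_ifs with hk
    · rw [hk, hσ]
    · exact huniq k j hk
  have hinj : Function.Injective σ := by
    intro i j hij
    by_contra hne
    have := hgram i j
    simp [hU, hij, hne] at this
  refine ⟨Equiv.ofBijective σ (Finite.injective_iff_bijective.1 hinj), fun i j => ?_⟩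
  have hcomm := congrFun (congrFun h.comm (σ i)) j
  simpa [mul_apply, hU, hinj.eq_iff] using hcomm

end Existence

/-! ### Graphs -/

section Graph

variable {n : ℕ}

theorem isSymm_adj (G : SimpleGraph (Fin n)) : (adj G).IsSymm := by
  classical
  exact G.isSymm_adjMatrix

theorem adj_apply_self (G : SimpleGraph (Fin n)) (i : Fin n) : adj G i i = 0 := by
  simp [adj]

theorem adj_compl (G : SimpleGraph (Fin n)) : adj Gᶜ = -(adj G - allOne n) - 1 := by
  ext i j
  by_cases hij : i = j
  · simp [adj, allOne, hij]
  · by_cases h : G.Adj i j <;> simp [adj, allOne, hij, h]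

theorem card_spec (G : SimpleGraph (Fin n)) : (spec G).card = n := by
  rw [spec, ← (IsAlgClosed.splits _).natDegree_eq_card_roots, charpoly_natDegree_eq_dim,
    Fintype.card_fin]

theorem charpoly_eq_of_spec_eq {G H : SimpleGraph (Fin n)} (h : spec H = spec G) :
    (adj H).charpoly = (adj G).charpoly := by
  apply map_injective (Int.castRingHom ℂ) (RingHom.injective_int _)
  rw [← charpoly_map, ← charpoly_map,
    (IsAlgClosed.splits ((adj H).map (Int.castRingHom ℂ)).charpoly).eq_prod_roots_of_monic
      (charpoly_monic _),
    (IsAlgClosed.splits ((adj G).map (Int.castRingHom ℂ)).charpoly).eq_prod_roots_of_monic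
      (charpoly_monic _)]
  exact congrArg (fun s : Multiset ℂ => (s.map fun a => X - C a).prod) h

theorem charpoly_sub_allOne_eq {G H : SimpleGraph (Fin n)} (h : spec Hᶜ = spec Gᶜ) :
    (adj H - allOne n).charpoly = (adj G - allOne n).charpoly := by
  have h1 := charpoly_eq_of_spec_eq h
  rw [adj_compl, adj_compl, charpoly_neg_sub_one, charpoly_neg_sub_one] at h1
  have h2 := mul_left_cancel₀ (pow_ne_zero n (neg_ne_zero.2 one_ne_zero)) h1
  have h3 := congrArg (fun f => f.comp (-X - 1 : ℤ[X])) h2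
  simp only [comp_assoc] at h3
  have h4 : (-X - 1 : ℤ[X]).comp (-X - 1) = X := by simp
  simpa [h4] using h3

theorem nonempty_iso_of_perm {G H : SimpleGraph (Fin n)} (σ : Equiv.Perm (Fin n))
    (h : ∀ i j, adj G (σ i) (σ j) = adj H i j) : Nonempty (H ≃g G) := by
  refine ⟨⟨σ, fun {i j} => ?_⟩⟩
  have := h i j
  simp only [adj, SimpleGraph.adjMatrix_apply] at this
  split_ifs at this <;> simp_all

end Graph

/-- The contradiction for a prime divisor `p` of the level: `p²` divides `θ(G)`, and the irreducible
polynomial belonging to the column space of `U` modulo `p` violates the minimality condition. -/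
theorem not_dvd_level {n : ℕ} {G : SimpleGraph (Fin n)} (hodd : Odd (theta G))
    (hmin : ∀ (p : ℕ) [Fact p.Prime], p ^ 2 ∣ theta G →
      ∀ φ : (ZMod p)[X], φ.Monic → Irreducible φ → φ ^ 2 ∣ Phi p G →
        min (ordDet φ (adj G)) (ordDet φ (adj G + allOne n)) = (φ.natDegree : ℕ∞))
    {B U : Matrix (Fin n) (Fin n) ℤ} {l : ℤ} (h : IsIntertwiner (adj G) B U l)
    {p : ℕ} [Fact p.Prime] (hU : U.map (Int.castRingHom (ZMod p)) ≠ 0) : ¬ (p : ℤ) ∣ l := by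
  intro hl
  have hn : 0 < n := by
    rcases Nat.eq_zero_or_pos n with rfl | hn
    · exact absurd (Subsingleton.elim _ _) hU
    · exact hn
  obtain ⟨φ, hmon, hφ, z, hz, hφz⟩ := h.exists_irreducible hU
  have hsq := h.sq_dvd_charpoly_map hl hφ hz hφz
  have hdisc : (p : ℤ) ^ 2 ∣ discriminant G := by
    refine dvd_discr_charpoly hn _ ?_
    have h1 := h.pow_succ_dvd_det_aeval hl hφ hz hφz (f := derivative (adj G).charpoly) (by
      rw [← derivative_map]
      simpa using pow_sub_one_dvd_derivative_of_pow_dvd hsq)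
    exact (pow_dvd_pow _ (Nat.succ_le_succ hφ.natDegree_pos)).trans h1
  have hWmul : 2 ^ (n / 2) * ((walkMatrix G).det / 2 ^ (n / 2)) = (walkMatrix G).det :=
    Int.mul_ediv_cancel' (two_pow_dvd_det_walk _ h.symm (adj_apply_self G))
  have hW := h.sq_dvd_det_walk hl hU
  change _ ∣ (walkMatrix G).det at hW
  by_cases hp2 : p = 2
  · subst hp2
    have h1 := h.two_pow_succ_dvd_det_walk (adj_apply_self G) hl hU
    change _ ∣ (walkMatrix G).det at h1
    rw [← hWmul, pow_succ] at h1
    have h2 := (mul_dvd_mul_iff_left (pow_ne_zero _ two_ne_zero)).1 h1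
    have h3 : (2 : ℤ) ∣ (theta G : ℤ) :=
      Int.dvd_coe_gcd h2 ((dvd_pow_self _ two_ne_zero).trans hdisc)
    rw [← Nat.not_even_iff_odd] at hodd
    exact hodd (even_iff_two_dvd.2 (by exact_mod_cast h3))
  · have hcop : IsCoprime ((p : ℤ) ^ 2) (2 ^ (n / 2)) := by
      refine IsCoprime.pow (Nat.isCoprime_iff_coprime.2 ?_)
      exact (Nat.coprime_primes Fact.out Nat.prime_two).2 hp2
    rw [← hWmul] at hW
    have h2 : ((p ^ 2 : ℕ) : ℤ) ∣ (theta G : ℤ) := by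
      rw [Nat.cast_pow]
      exact Int.dvd_coe_gcd (hcop.dvd_of_dvd_mul_left hW) hdisc
    have hJ := h.add_allOne
    have hφzJ := h.aeval_add_allOne_mulVec hl φ z
    rw [hφz] at hφzJ
    have hPhi : φ ^ 2 ∣ Phi p G :=
      (EuclideanDomain.dvd_gcd hsq (hJ.sq_dvd_charpoly_map hl hφ hz hφzJ)).trans
        (dvd_normalize_iff.2 dvd_rfl)
    have hlift : φ ∣ (lift φ).map (Int.castRingHom (ZMod p)) := by rw [map_lift]
    have h3 := le_emultiplicity_of_pow_dvd (h.pow_succ_dvd_det_aeval hl hφ hz hφz hlift)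
    have h4 := le_emultiplicity_of_pow_dvd (hJ.pow_succ_dvd_det_aeval hl hφ hz hφzJ hlift)
    have h5 := (le_min h3 h4).trans_eq (hmin p (by exact_mod_cast h2) φ hmon hφ hPhi)
    have h6 : φ.natDegree + 1 ≤ φ.natDegree := by exact_mod_cast h5
    omega

end GenSpectrum

theorem theorem2 (n : ℕ) (G : SimpleGraph (Fin n))
    (hG : GenSpectrum.IsControllable G)
    (hodd : Odd (GenSpectrum.theta G))
    (hmin : ∀ (p : ℕ) [Fact p.Prime], p ^ 2 ∣ GenSpectrum.theta G →
      ∀ φ : (ZMod p)[X], φ.Monic → Irreducible φ → φ ^ 2 ∣ GenSpectrum.Phi p G →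
        min (GenSpectrum.ordDet φ (GenSpectrum.adj G))
          (GenSpectrum.ordDet φ (GenSpectrum.adj G + GenSpectrum.allOne n)) =
            (φ.natDegree : ℕ∞)) :
    GenSpectrum.IsDGS G := by
  intro m H hspec
  simp only [GenSpectrum.genSpec, Prod.mk.injEq] at hspec
  obtain rfl : m = n := by rw [← GenSpectrum.card_spec H, hspec.1, GenSpectrum.card_spec]
  obtain ⟨l, U, hl, hU, hprim⟩ := GenSpectrum.exists_primitive_isIntertwiner (GenSpectrum.isSymm_adj G) (GenSpectrum.isSymm_adj H)
    (GenSpectrum.walkCount_eq (GenSpectrum.charpoly_eq_of_spec_eq hspec.1).symm (GenSpectrum.charpoly_sub_allOne_eq hspec.2).symm) hG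
  obtain rfl : l = 1 := by
    by_contra hne
    obtain ⟨p, hp, hpl⟩ := Nat.exists_prime_and_dvd hne
    have : Fact p.Prime := ⟨hp⟩
    exact GenSpectrum.not_dvd_level hodd hmin hU (hprim p hp hpl) (by exact_mod_cast hpl)
  obtain ⟨σ, hσ⟩ := hU.exists_perm
  exact GenSpectrum.nonempty_iso_of_perm σ hσ
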